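/- Let $V$ be a Euclidean space with inner product $x\cdot y$. An even lattice in $V$ is a lattice $L\subset V$ (of full rank) with $x\cdot x\in 2\mathbb{Z}$ for all $x\in L$; its dual lattice is $L^\sharp=\{x\in V : x\cdot L\subset\mathbb{Z}\}\supset L$. Let $\mathrm{O}(L)$ be the group of $\mathbb{Z}$-linear automorphisms of $L$ preserving the quadratic form $x\mapsto \frac{x\cdot x}{2}$. The residue $\operatorname{res} L$ is the finite abelian group $L^\sharp/L$ equipped with the $\mathbb{Q}/\mathbb{Z}$-valued quadratic form $x\mapsto \frac{x\cdot x}{2} \bmod \mathbb{Z}$, and $\mathrm{O}(\operatorname{res} L)$ is the group of automorphisms of $L^\sharp/L$ preserving this form. Every element of $\mathrm{O}(L)$ extends uniquely to an $\mathbb{R}$-linear automorphism of $V$, which preserves $L^\sharp$ and $L$; this induces the natural morphism $\mathrm{O}(L)\to\mathrm{O}(\operatorname{res} L)$. Let $(g,p,R)$ be either $(6,3,3\,\mathbf{A}_2)$ or $(8,5,2\,\mathbf{A}_4)$, where $k\,\mathbf{A}_l$ denotes the orthogonal sum of $k$ copies of the root system $\mathbf{A}_l$ (with roots of norm $\alpha\cdot\alpha=2$).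 Let $\mathrm{Q}(R)$ be the root lattice generated by $R$, let $\rho$ be a Weyl vector of $R$, that is, the half-sum of the elements of some positive system of $R$, and set $$\mathrm{Q}_g=\{x\in \mathrm{Q}(R) : x\cdot\rho\equiv 0 \bmod p\},$$ an even lattice of rank $g$. Proposition. For $g=6$ and $g=8$, the natural morphism $\mathrm{O}(\mathrm{Q}_g)\to\mathrm{O}(\operatorname{res}\mathrm{Q}_g)$ is an isomorphism. -/

import Mathlib

open scoped InnerProductSpace

noncomputable section

namespace EvenLat

/-! ### Quadratic spaces and their isometry groups -/

/-- The isometry group `O(M)` of a `k`-module `M` equipped with a map `q : M → N`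
(a quadratic map in the applications): the `k`-linear automorphisms `f` of `M`
with `q ∘ f = q`. -/
def isometryGroup (k : Type*) {M N : Type*} [CommRing k] [AddCommGroup M] [Module k M]
    (q : M → N) : Subgroup (M ≃ₗ[k] M) where
  carrier := {f | ∀ x, q (f x) = q x}
  one_mem' := fun _ => rfl
  mul_mem' := fun {f g} hf hg x => by
    rw [LinearEquiv.mul_apply, hf, hg]
  inv_mem' := fun {f} hf x => by
    have h := hf (f⁻¹ x)
    rw [← LinearEquiv.mul_apply, mul_inv_cancel, LinearEquiv.coe_one, id] at h
    exact h.symm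

/-! ### Even lattices in a Euclidean space -/

section

variable (V : Type*) [NormedAddCommGroup V] [InnerProductSpace ℝ V]

/-- An even lattice in the Euclidean space `V`: a subgroup spanning `V` over `ℝ` on which
`x · x` is an even integer. Discreteness follows from evenness, see
`EvenLattice.instDiscreteTopology`. -/
structure EvenLattice where
  carrier : Submodule ℤ V
  span_eq_top : Submodule.span ℝ (carrier : Set V) = ⊤
  even : ∀ x ∈ carrier, ∃ n : ℤ, ⟪x, x⟫_ℝ = 2 * n

variable {V}

namespace EvenLattice

variable (L : EvenLattice V)

instance instDiscreteTopology : DiscreteTopology L.carrier := by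
  apply discreteTopology_of_isOpen_singleton_zero
  have : ({0} : Set L.carrier) = Metric.ball 0 1 := by
    ext x
    simp only [Set.mem_singleton_iff, Metric.mem_ball, dist_zero_right]
    constructor
    · rintro rfl
      simp
    · intro hx
      obtain ⟨n, hn⟩ := L.even x x.2
      rw [real_inner_self_eq_norm_sq] at hn
      have hx' : ‖(x : V)‖ < 1 := hx
      have h0 := norm_nonneg (x : V)
      have h1 : (2 * n : ℝ) < 1 := by rw [← hn]; nlinarith
      have h2 : (0 : ℝ) ≤ 2 * n := by rw [← hn]; positivity
      have h3 : n = 0 := by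
        have a : 2 * n < 1 := by exact_mod_cast h1
        have b : 0 ≤ 2 * n := by exact_mod_cast h2
        omega
      rw [h3] at hn
      have : ‖(x : V)‖ = 0 := by
        simpa using hn
      exact Subtype.ext (norm_eq_zero.mp this)
  rw [this]
  exact Metric.isOpen_ball

instance instIsZLattice : IsZLattice ℝ L.carrier := ⟨L.span_eq_top⟩

/-- The quadratic form `x ↦ (x · x) / 2` of `L`. -/
def quad (x : L.carrier) : ℝ := ⟪(x : V), (x : V)⟫_ℝ / 2

/-- The orthogonal group `O(L)`. -/
abbrev O : Subgroup (L.carrier ≃ₗ[ℤ] L.carrier) := isometryGroup ℤ L.quad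

/-- The dual lattice `L♯ = {x ∈ V | x · L ⊆ ℤ}`. -/
def dual : Submodule ℤ V where
  carrier := {x | ∀ y ∈ L.carrier, ∃ n : ℤ, ⟪x, y⟫_ℝ = n}
  zero_mem' := fun y _ => ⟨0, by simp⟩
  add_mem' := fun {a b} ha hb y hy => by
    obtain ⟨m, hm⟩ := ha y hy
    obtain ⟨n, hn⟩ := hb y hy
    exact ⟨m + n, by rw [inner_add_left, hm, hn]; push_cast; rfl⟩
  smul_mem' := fun c a ha y hy => by
    obtain ⟨m, hm⟩ := ha y hy
    refine ⟨c * m, ?_⟩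
    rw [← Int.cast_smul_eq_zsmul ℝ, real_inner_smul_left, hm]
    push_cast
    rfl

/-- The underlying abelian group `L♯ / L` of the residue of `L`. -/
abbrev Res : Type _ := L.dual ⧸ L.carrier.submoduleOf L.dual

/-- The quadratic form `x ↦ (x · x) / 2 mod ℤ` of the residue. Its values lie in `ℚ/ℤ`,
seen here inside `ℝ/ℤ`. -/
def resQuad (x : L.Res) : AddCircle (1 : ℝ) :=
  Quotient.liftOn' x (fun y => ((⟪(y : V), (y : V)⟫_ℝ / 2 : ℝ) : AddCircle (1 : ℝ))) (by
    intro a b hab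
    rw [Submodule.quotientRel_def] at hab
    have hl : (a : V) - (b : V) ∈ L.carrier := hab
    obtain ⟨m, hm⟩ := b.2 _ hl
    obtain ⟨n, hn⟩ := L.even _ hl
    have key : ⟪(a : V), (a : V)⟫_ℝ / 2 = ⟪(b : V), (b : V)⟫_ℝ / 2 + ((m + n : ℤ) : ℝ) := by
      have h : (a : V) = b + (a - b) := by abel
      rw [h, inner_add_left, inner_add_right, inner_add_right,
        real_inner_comm (b : V) ((a : V) - b), hm, hn]
      push_cast
      ring
    change ((⟪(a : V), (a : V)⟫_ℝ / 2 : ℝ) : AddCircle (1 : ℝ)) = _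
    rw [key]
    rw [AddCircle.coe_add, add_eq_left, AddCircle.coe_eq_zero_iff]
    exact ⟨m + n, by simp⟩)

/-- The orthogonal group `O(res L)` of the residue. -/
abbrev ORes : Subgroup (L.Res ≃ₗ[ℤ] L.Res) := isometryGroup ℤ L.resQuad

/-! ### The natural morphism `O(L) → O(res L)` -/

theorem eq_of_eq_on {W : Type*} [AddCommGroup W] [Module ℝ W] {f g : V →ₗ[ℝ] W}
    (h : ∀ x ∈ L.carrier, f x = g x) : f = g :=
  LinearMap.ext_on L.span_eq_top (fun _ hx => h _ hx)

variable [FiniteDimensional ℝ V]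

/-- The unique `ℝ`-linear extension to `V` of an endomorphism of `L`. -/
def extend (f : L.carrier →ₗ[ℤ] L.carrier) : V →ₗ[ℝ] V :=
  ((Module.Free.chooseBasis ℤ L.carrier).ofZLatticeBasis ℝ L.carrier).constr ℝ
    (fun i => (f (Module.Free.chooseBasis ℤ L.carrier i) : V))

theorem extend_apply (f : L.carrier →ₗ[ℤ] L.carrier) (x : L.carrier) :
    L.extend f x = f x := by
  have : ((L.extend f).restrictScalars ℤ) ∘ₗ L.carrier.subtype = L.carrier.subtype ∘ₗ f := by
    refine (Module.Free.chooseBasis ℤ L.carrier).ext fun i => ?_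
    have := ((Module.Free.chooseBasis ℤ L.carrier).ofZLatticeBasis ℝ L.carrier).constr_basis ℝ
      (fun i => (f (Module.Free.chooseBasis ℤ L.carrier i) : V)) i
    rw [Module.Basis.ofZLatticeBasis_apply] at this
    exact this
  exact LinearMap.congr_fun this x

/-- The unique `ℝ`-linear extension to `V` of an automorphism of `L`. -/
def extendEquiv (f : L.carrier ≃ₗ[ℤ] L.carrier) : V ≃ₗ[ℝ] V :=
  LinearEquiv.ofLinearMap (L.extend f.toLinearMap) (L.extend f.symm.toLinearMap)
    (L.eq_of_eq_on fun x hx => by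
      simp [L.extend_apply _ ⟨x, hx⟩, L.extend_apply])
    (L.eq_of_eq_on fun x hx => by
      simp [L.extend_apply _ ⟨x, hx⟩, L.extend_apply])

theorem extendEquiv_apply (f : L.carrier ≃ₗ[ℤ] L.carrier) (x : L.carrier) :
    L.extendEquiv f x = f x :=
  L.extend_apply _ x

theorem extendEquiv_one : L.extendEquiv 1 = 1 := by
  apply LinearEquiv.toLinearMap_injective
  exact L.eq_of_eq_on fun x hx => L.extendEquiv_apply 1 ⟨x, hx⟩

theorem extendEquiv_mul (f g : L.carrier ≃ₗ[ℤ] L.carrier) :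
    L.extendEquiv (f * g) = L.extendEquiv f * L.extendEquiv g := by
  apply LinearEquiv.toLinearMap_injective
  refine L.eq_of_eq_on fun x hx => ?_
  have h1 := L.extendEquiv_apply (f * g) ⟨x, hx⟩
  have h2 := L.extendEquiv_apply g ⟨x, hx⟩
  have h3 := L.extendEquiv_apply f (g ⟨x, hx⟩)
  change L.extendEquiv (f * g) x = L.extendEquiv f (L.extendEquiv g x)
  simp only at h1 h2
  rw [h1, h2, h3]
  rfl

theorem inner_extendEquiv (f : L.O) (x y : V) :
    ⟪L.extendEquiv f.1 x, L.extendEquiv f.1 y⟫_ℝ = ⟪x, y⟫_ℝ := by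
  have hq (a : L.carrier) : ⟪(f.1 a : V), (f.1 a : V)⟫_ℝ = ⟪(a : V), (a : V)⟫_ℝ := by
    have := f.2 a
    simp only [quad] at this
    linarith
  have hb (a b : L.carrier) : ⟪(f.1 a : V), (f.1 b : V)⟫_ℝ = ⟪(a : V), (b : V)⟫_ℝ := by
    have h1 := hq (a + b)
    have h2 := hq a
    have h3 := hq b
    simp only [map_add, Submodule.coe_add, real_inner_add_add_self] at h1
    linarith
  have key : ((innerₗ V).compl₁₂ (L.extendEquiv f.1).toLinearMap
      (L.extendEquiv f.1).toLinearMap) = innerₗ V := by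
    refine L.eq_of_eq_on fun a ha => L.eq_of_eq_on fun b hb' => ?_
    have h1 := L.extendEquiv_apply f.1 ⟨a, ha⟩
    have h2 := L.extendEquiv_apply f.1 ⟨b, hb'⟩
    simp only at h1 h2
    simp only [LinearMap.compl₁₂_apply, LinearEquiv.coe_coe, innerₗ_apply_apply, h1, h2]
    exact hb _ _
  exact LinearMap.congr_fun (LinearMap.congr_fun key x) y

theorem extendEquiv_mem_dual (f : L.O) {x : V} (hx : x ∈ L.dual) :
    L.extendEquiv f.1 x ∈ L.dual := by
  intro y hy
  obtain ⟨n, hn⟩ := hx _ (f.1.symm ⟨y, hy⟩).2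
  refine ⟨n, ?_⟩
  rw [← hn, ← L.inner_extendEquiv f x (f.1.symm ⟨y, hy⟩), L.extendEquiv_apply,
    LinearEquiv.apply_symm_apply]

/-- The action of `f ∈ O(L)` on `L♯`. -/
def dualMap (f : L.O) : L.dual →ₗ[ℤ] L.dual :=
  ((L.extendEquiv f.1).toLinearMap.restrictScalars ℤ).restrict
    (fun _ hx => L.extendEquiv_mem_dual f hx)

/-- The action of `f ∈ O(L)` on `L♯ / L`. -/
def resMap (f : L.O) : L.Res →ₗ[ℤ] L.Res :=
  Submodule.mapQ _ _ (L.dualMap f) (fun x hx => by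
    change L.extendEquiv f.1 (x : V) ∈ L.carrier
    have := L.extendEquiv_apply f.1 ⟨(x : V), hx⟩
    simp only at this
    rw [this]
    exact Subtype.property _)

theorem resMap_one : L.resMap 1 = LinearMap.id := by
  refine LinearMap.ext fun x => ?_
  obtain ⟨x, rfl⟩ := Submodule.Quotient.mk_surjective _ x
  change Submodule.Quotient.mk (L.dualMap 1 x) = Submodule.Quotient.mk x
  congr 1
  apply Subtype.ext
  change L.extendEquiv 1 (x : V) = x
  rw [extendEquiv_one]
  rfl

theorem resMap_mul (f g : L.O) : L.resMap (f * g) = L.resMap f ∘ₗ L.resMap g := by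
  refine LinearMap.ext fun x => ?_
  obtain ⟨x, rfl⟩ := Submodule.Quotient.mk_surjective _ x
  change Submodule.Quotient.mk (L.dualMap (f * g) x) =
    Submodule.Quotient.mk (L.dualMap f (L.dualMap g x))
  congr 1
  apply Subtype.ext
  change L.extendEquiv (f.1 * g.1) (x : V) = L.extendEquiv f.1 (L.extendEquiv g.1 (x : V))
  rw [extendEquiv_mul]
  rfl

theorem resQuad_resMap (f : L.O) (x : L.Res) : L.resQuad (L.resMap f x) = L.resQuad x := by
  obtain ⟨x, rfl⟩ := Submodule.Quotient.mk_surjective _ x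
  change ((⟪L.extendEquiv f.1 (x : V), L.extendEquiv f.1 (x : V)⟫_ℝ / 2 : ℝ) : AddCircle (1 : ℝ)) =
    ((⟪(x : V), (x : V)⟫_ℝ / 2 : ℝ) : AddCircle (1 : ℝ))
  rw [inner_extendEquiv]

/-- The natural morphism `O(L) → O(res L)`: an isometry of `L` extends uniquely to `V`,
the extension preserves `L♯`, and one reduces it modulo `L`. -/
def resHom : L.O →* L.ORes where
  toFun f :=
    ⟨LinearEquiv.ofLinearMap (L.resMap f) (L.resMap f⁻¹)
      (by rw [← resMap_mul, mul_inv_cancel, resMap_one])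
      (by rw [← resMap_mul, inv_mul_cancel, resMap_one]), L.resQuad_resMap f⟩
  map_one' := Subtype.ext (LinearEquiv.toLinearMap_injective L.resMap_one)
  map_mul' f g := Subtype.ext (LinearEquiv.toLinearMap_injective (L.resMap_mul f g))

end EvenLattice

/-! ### Weyl vectors and the lattices `Q_g` -/

/-- `ρ` is a Weyl vector of the (finite) root system `R` in `V`: the half-sum of the elements
of a positive system of `R`, i.e. of the roots `α` with `v · α > 0` for some `v` in `V`
orthogonal to no root. -/
def IsWeylVector (R : Finset V) (ρ : V) : Prop :=
  ∃ v : V, (∀ α ∈ R, ⟪v, α⟫_ℝ ≠ 0) ∧ ρ = (1 / 2 : ℝ) • ∑ α ∈ R with 0 < ⟪v, α⟫_ℝ, α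

/-- The root lattice `Q(R)`. -/
def rootLattice (R : Finset V) : Submodule ℤ V := Submodule.span ℤ (R : Set V)

/-- The subgroup `{x ∈ Q(R) | x · ρ ≡ 0 mod h}` of the root lattice `Q(R)`. -/
def weylSublattice (R : Finset V) (ρ : V) (h : ℕ) : Submodule ℤ V where
  carrier := {x | x ∈ rootLattice R ∧ ∃ n : ℤ, ⟪x, ρ⟫_ℝ = h * n}
  zero_mem' := ⟨zero_mem _, 0, by simp⟩
  add_mem' := fun {a b} ⟨ha, m, hm⟩ ⟨hb, n, hn⟩ =>
    ⟨add_mem ha hb, m + n, by rw [inner_add_left, hm, hn]; push_cast; ring⟩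
  smul_mem' := fun c a ⟨ha, m, hm⟩ => ⟨Submodule.smul_mem _ c ha, c * m, by
    rw [← Int.cast_smul_eq_zsmul ℝ, real_inner_smul_left, hm]; push_cast; ring⟩

end

/-- The Euclidean space of the root system `k 𝐀_l`: the vectors of `(ℝ^(l+1))^k` each of whose
`k` components has coordinates of sum `0`. -/
def spaceA (k l : ℕ) : Submodule ℝ (EuclideanSpace ℝ (Fin k × Fin (l + 1))) where
  carrier := {x | ∀ c, ∑ i, x (c, i) = 0}
  zero_mem' := fun c => by simp
  add_mem' := fun {a b} ha hb c => by simp [Finset.sum_add_distrib, ha c, hb c]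
  smul_mem' := fun r a ha c => by simp [← Finset.mul_sum, ha c]

/-- The vector `e_i - e_j` in the `c`-th component. -/
def rootA {k l : ℕ} (c : Fin k) (i j : Fin (l + 1)) : spaceA k l :=
  ⟨EuclideanSpace.single (c, i) 1 - EuclideanSpace.single (c, j) 1, fun d => by
    by_cases h : d = c <;> simp [h]⟩

open Classical in
/-- The root system `k 𝐀_l`, orthogonal sum of `k` copies of `𝐀_l`. -/
def rootsA (k l : ℕ) : Finset (spaceA k l) :=
  ((Finset.univ : Finset (Fin k × Fin (l + 1) × Fin (l + 1))).filter
    (fun t => t.2.1 ≠ t.2.2)).image (fun t => rootA t.1 t.2.1 t.2.2)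

theorem inner_rootsA {k l : ℕ} {α β : spaceA k l} (hα : α ∈ rootsA k l) (hβ : β ∈ rootsA k l) :
    ∃ n : ℤ, ⟪α, β⟫_ℝ = n := by
  simp only [rootsA, Finset.mem_image] at hα hβ
  obtain ⟨⟨c, i, j⟩, -, rfl⟩ := hα
  obtain ⟨⟨d, i', j'⟩, -, rfl⟩ := hβ
  refine ⟨(if (c, i) = (d, i') then 1 else 0) - (if (c, i) = (d, j') then 1 else 0)
    - ((if (c, j) = (d, i') then 1 else 0) - (if (c, j) = (d, j') then 1 else 0)), ?_⟩
  rw [Submodule.coe_inner]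
  simp [rootA, inner_sub_left, EuclideanSpace.inner_single_left]

theorem inner_self_rootsA {k l : ℕ} {α : spaceA k l} (hα : α ∈ rootsA k l) :
    ⟪α, α⟫_ℝ = 2 := by
  simp only [rootsA, Finset.mem_image, Finset.mem_filter] at hα
  obtain ⟨⟨c, i, j⟩, ⟨-, hij⟩, rfl⟩ := hα
  have hij' : i ≠ j := hij
  rw [Submodule.coe_inner, rootA, inner_sub_left, EuclideanSpace.inner_single_left,
    EuclideanSpace.inner_single_left]
  simp [hij', hij'.symm]
  norm_num

theorem even_rootLatticeA {k l : ℕ} {x : spaceA k l} (hx : x ∈ rootLattice (rootsA k l)) :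
    ∃ n : ℤ, ⟪x, x⟫_ℝ = 2 * n := by
  have hint : ∀ x ∈ rootLattice (rootsA k l), ∀ y ∈ rootLattice (rootsA k l),
      ∃ n : ℤ, ⟪x, y⟫_ℝ = n := by
    intro x hx y hy
    induction hx, hy using Submodule.span_induction₂ with
    | mem_mem x y hx hy => exact inner_rootsA hx hy
    | zero_left y hy => exact ⟨0, by simp⟩
    | zero_right x hx => exact ⟨0, by simp⟩
    | add_left x y z _ _ _ h1 h2 =>
      obtain ⟨m, hm⟩ := h1
      obtain ⟨n, hn⟩ := h2
      exact ⟨m + n, by rw [inner_add_left, hm, hn]; push_cast; rfl⟩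
    | add_right x y z _ _ _ h1 h2 =>
      obtain ⟨m, hm⟩ := h1
      obtain ⟨n, hn⟩ := h2
      exact ⟨m + n, by rw [inner_add_right, hm, hn]; push_cast; rfl⟩
    | smul_left r x y _ _ h =>
      obtain ⟨m, hm⟩ := h
      exact ⟨r * m, by rw [← Int.cast_smul_eq_zsmul ℝ, real_inner_smul_left, hm]; push_cast; rfl⟩
    | smul_right r x y _ _ h =>
      obtain ⟨m, hm⟩ := h
      exact ⟨r * m, by rw [← Int.cast_smul_eq_zsmul ℝ, real_inner_smul_right, hm]; push_cast; rfl⟩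
  induction hx using Submodule.span_induction with
  | mem x hx => exact ⟨1, by rw [inner_self_rootsA hx]; norm_num⟩
  | zero => exact ⟨0, by simp⟩
  | add x y hx hy h1 h2 =>
    obtain ⟨a, ha⟩ := h1
    obtain ⟨b, hb⟩ := h2
    obtain ⟨c, hc⟩ := hint x hx y hy
    exact ⟨a + c + b, by rw [real_inner_add_add_self, ha, hb, hc]; push_cast; ring⟩
  | smul r x _ h =>
    obtain ⟨a, ha⟩ := h
    exact ⟨r * r * a, by
      rw [← Int.cast_smul_eq_zsmul ℝ, real_inner_smul_left, real_inner_smul_right, ha]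
      push_cast
      ring⟩

theorem span_rootsA (k l : ℕ) : Submodule.span ℝ (rootsA k l : Set (spaceA k l)) = ⊤ := by
  rw [eq_top_iff]
  rintro x -
  have hx : x = ∑ c, ∑ i, (x : EuclideanSpace ℝ _) (c, i) • rootA c i 0 := by
    apply Subtype.ext
    ext ⟨d, j⟩
    have h0 := x.2 d
    simp only [Submodule.coe_sum, Submodule.coe_smul, rootA, smul_sub,
      Finset.sum_sub_distrib, PiLp.sub_apply, WithLp.ofLp_sum, Finset.sum_apply,
      PiLp.smul_apply, PiLp.single_apply, Prod.mk.injEq, smul_eq_mul, mul_ite, mul_one,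
      mul_zero]
    rw [Finset.sum_eq_single d, Finset.sum_eq_single d]
    · by_cases hj : j = 0
      · simp [hj, h0]
      · simp [hj]
    · intro b _ hb
      simp [hb.symm]
    · simp
    · intro b _ hb
      simp [hb.symm]
    · simp
  rw [hx]
  refine Submodule.sum_mem _ fun c _ => Submodule.sum_mem _ fun i _ => Submodule.smul_mem _ _ ?_
  by_cases hi : i = 0
  · subst hi
    have : (rootA c 0 0 : spaceA k l) = 0 := Subtype.ext (sub_self _)
    rw [this]
    exact zero_mem _
  · exact Submodule.subset_span (Finset.mem_coe.2
      (Finset.mem_image.2 ⟨(c, i, 0), Finset.mem_filter.2 ⟨Finset.mem_univ _, hi⟩, rfl⟩))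

/-- Weyl vectors of `k 𝐀_l` exist. -/
theorem exists_isWeylVector (k l : ℕ) : ∃ ρ : spaceA k l, IsWeylVector (rootsA k l) ρ := by
  let w : EuclideanSpace ℝ (Fin k × Fin (l + 1)) :=
    WithLp.toLp 2 (fun t => ((t.2 : ℕ) : ℝ) - (∑ j : Fin (l + 1), ((j : ℕ) : ℝ)) / (l + 1))
  have hw : w ∈ spaceA k l := fun c => by
    have h : ((l : ℝ) + 1) ≠ 0 := by positivity
    simp only [w, Finset.sum_sub_distrib, Finset.sum_const, Finset.card_univ, Fintype.card_fin,
      nsmul_eq_mul]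
    push_cast
    field_simp
    ring
  refine ⟨_, ⟨w, hw⟩, fun α hα => ?_, rfl⟩
  simp only [rootsA, Finset.mem_image, Finset.mem_filter] at hα
  obtain ⟨⟨c, i, j⟩, ⟨-, hij⟩, rfl⟩ := hα
  have hij' : ((i : ℕ) : ℝ) ≠ ((j : ℕ) : ℝ) := fun h => hij (Fin.ext (by exact_mod_cast h))
  rw [Submodule.coe_inner, rootA, inner_sub_right, EuclideanSpace.inner_single_right,
    EuclideanSpace.inner_single_right]
  simpa [w, sub_eq_zero] using hij'

/-- For a Weyl vector `ρ` of the root system `R = k 𝐀_l`, with Coxeter number `l + 1`, the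
even lattice `{x ∈ Q(R) | x · ρ ≡ 0 mod l + 1}`. -/
def latticeQ (k l : ℕ) (ρ : spaceA k l) (hρ : IsWeylVector (rootsA k l) ρ) :
    EvenLattice (spaceA k l) where
  carrier := weylSublattice (rootsA k l) ρ (l + 1)
  span_eq_top := by
    rw [eq_top_iff, ← span_rootsA, Submodule.span_le]
    intro α hα
    obtain ⟨v, -, hρv⟩ := hρ
    have hint : ∀ s : Finset (spaceA k l), s ⊆ rootsA k l → ∃ n : ℤ, ⟪α, ∑ β ∈ s, β⟫_ℝ = n := by
      intro s hs
      have : ∀ β : spaceA k l, ∃ n : ℤ, β ∈ s → ⟪α, β⟫_ℝ = n := fun β => by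
        by_cases hβ : β ∈ s
        · obtain ⟨n, hn⟩ := inner_rootsA hα (hs hβ)
          exact ⟨n, fun _ => hn⟩
        · exact ⟨0, fun h => absurd h hβ⟩
      choose n hn using this
      refine ⟨∑ β ∈ s, n β, ?_⟩
      rw [inner_sum, Int.cast_sum]
      exact Finset.sum_congr rfl hn
    obtain ⟨n, hn⟩ := hint _ (Finset.filter_subset (fun β => 0 < ⟪v, β⟫_ℝ) _)
    have hn' : ⟪α, ρ⟫_ℝ = (1 / 2 : ℝ) * n := by
      rw [hρv, ← hn]
      exact real_inner_smul_right _ _ _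
    have hmem : (2 * (l + 1 : ℕ) : ℤ) • α ∈ weylSublattice (rootsA k l) ρ (l + 1) := by
      refine ⟨Submodule.smul_mem _ _ (Submodule.subset_span hα), n, ?_⟩
      rw [← Int.cast_smul_eq_zsmul ℝ, real_inner_smul_left, hn']
      push_cast
      ring
    have h2 := Submodule.smul_mem (Submodule.span ℝ _) ((2 * (l + 1 : ℕ) : ℝ)⁻¹)
      (Submodule.subset_span (R := ℝ) hmem)
    have h3 : ((2 * (l + 1 : ℕ) : ℝ)⁻¹) • ((2 * (l + 1 : ℕ) : ℤ) • α) = α := by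
      rw [← Int.cast_smul_eq_zsmul ℝ, smul_smul]
      have h4 : (2 * ((l + 1 : ℕ) : ℝ)) ≠ 0 := by positivity
      have h5 : ((2 * ((l + 1 : ℕ) : ℤ) : ℤ) : ℝ) = 2 * ((l + 1 : ℕ) : ℝ) := by push_cast; rfl
      rw [h5, inv_mul_cancel₀ h4, one_smul]
    rw [h3] at h2
    exact h2
  even := fun _ hx => even_rootLatticeA hx.1

/-- The lattice `Q_6`: here `R = 3 𝐀_2` and the congruence is modulo `3`. -/
abbrev Q6 (ρ : spaceA 3 2) (hρ : IsWeylVector (rootsA 3 2) ρ) : EvenLattice (spaceA 3 2) :=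
  latticeQ 3 2 ρ hρ

/-- The lattice `Q_8`: here `R = 2 𝐀_4` and the congruence is modulo `5`. -/
abbrev Q8 (ρ : spaceA 2 4) (hρ : IsWeylVector (rootsA 2 4) ρ) : EvenLattice (spaceA 2 4) :=
  latticeQ 2 4 ρ hρ

end EvenLat

end

open scoped InnerProductSpace

noncomputable section

namespace EvenLat

/-! ### A criterion: short dual vectors that rigidify the residue. -/

namespace EvenLattice

variable {V : Type*} [NormedAddCommGroup V] [InnerProductSpace ℝ V] (L : EvenLattice V)

/-! The proof recovers isometries of `L` from the minimal vectors of `L♯`. Suppose that `L♯` has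
minimum `m < 1`, that `L` has no vector of norm 2, and that the minimal vectors generate `L♯` and
represent every residue class whose norm is `m` modulo 2. Two minimal vectors congruent modulo `L`
are then equal, so an isometry of the residue is the same thing as a permutation of the minimal
vectors on their classes. The residue form determines inner products modulo 1; since distinct,
non-opposite minimal vectors have inner product at most `m / 2 < 1 / 2` in absolute value, the
permutation preserves the Gram matrix. It therefore extends to an isometry of `V`, unique because
the minimal vectors span. This is `EvenLattice.resHom_bijective`.

For `Q_g`, put `p = l + 1`. After permuting coordinates, the Weyl vector is `(0, …, l)` on each
component up to constants. So `L` consists of integral arrays with zero row sums and `∑ r z(c,r)`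
divisible by `p` (`mem_latticeQ_iff`), while `p L♯` consists of integral arrays with zero row sums
whose rows are affine functions of `r` modulo `p` with a common slope (`mem_dual_latticeQ_iff`).
Here `m = l / p`. The minimal arrays include the weight vectors of one copy of `𝐀_l` (slope 0) and
the arrays of centered residues (nonzero slope); the two kinds have the same norm because `k ∑ x² =
p l` over centered residues `x`. The hypotheses of the criterion are `IsLatArray.sum_sq_ne_two`,
`IsDualArray.le_sum_sq`, `IsDualArray.mem_span` and `IsDualArray.exists_minArray`. -/

theorem inner_mem_int {x y : V} (hx : x ∈ L.carrier) (hy : y ∈ L.carrier) :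
    ∃ n : ℤ, ⟪x, y⟫_ℝ = n := by
  obtain ⟨a, ha⟩ := L.even x hx
  obtain ⟨b, hb⟩ := L.even y hy
  obtain ⟨c, hc⟩ := L.even (x + y) (add_mem hx hy)
  refine ⟨c - a - b, ?_⟩
  rw [real_inner_add_add_self, ha, hb] at hc
  push_cast
  linarith

theorem carrier_le_dual : L.carrier ≤ L.dual := fun _ hx _ hy => L.inner_mem_int hx hy

/-- The class in `L♯ / L` of an element of `L♯`. -/
abbrev toRes (x : L.dual) : L.Res := Submodule.Quotient.mk x

variable {L}

theorem toRes_eq_iff {x y : L.dual} : L.toRes x = L.toRes y ↔ (x : V) - y ∈ L.carrier :=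
  Submodule.Quotient.eq _

theorem resQuad_eq_iff {x y : L.dual} :
    L.resQuad (L.toRes x) = L.resQuad (L.toRes y) ↔
      ∃ n : ℤ, ⟪(x : V), (x : V)⟫_ℝ = ⟪(y : V), (y : V)⟫_ℝ + 2 * n := by
  change ((⟪(x : V), (x : V)⟫_ℝ / 2 : ℝ) : AddCircle (1 : ℝ)) =
    ((⟪(y : V), (y : V)⟫_ℝ / 2 : ℝ) : AddCircle (1 : ℝ)) ↔ _
  rw [← sub_eq_zero, ← AddCircle.coe_sub, AddCircle.coe_eq_zero_iff]
  refine exists_congr fun n => ?_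
  rw [zsmul_eq_mul, mul_one]
  constructor <;> intro h <;> linarith

/-- Elements of `L♯` of norm `m`. -/
def shell (L : EvenLattice V) (m : ℝ) : Set V := {s | s ∈ L.dual ∧ ⟪s, s⟫_ℝ = m}

theorem neg_mem_shell {m : ℝ} {s : V} (hs : s ∈ L.shell m) : -s ∈ L.shell m :=
  ⟨neg_mem hs.1, by rw [inner_neg_neg, hs.2]⟩

variable {m : ℝ}

theorem inner_le_of_mem_shell (hmin : ∀ x ∈ L.dual, x ≠ 0 → m ≤ ⟪x, x⟫_ℝ) {s t : V}
    (hs : s ∈ L.shell m) (ht : t ∈ L.shell m) (h : s ≠ t) : ⟪s, t⟫_ℝ ≤ m / 2 := by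
  have := hmin (s - t) (sub_mem hs.1 ht.1) (sub_ne_zero.2 h)
  rw [real_inner_sub_sub_self, hs.2, ht.2] at this
  linarith

/-- If `s ≠ t`, the even integer `‖s - t‖² = 2m - 2 s·t` lies strictly between 0 and `4`, because
`-m ≤ s·t ≤ m / 2` and `m < 1`. It would be 2, which is excluded in `L`. -/
theorem eq_of_mem_shell (hm0 : 0 < m) (hm : m < 1) (h2 : ∀ x ∈ L.carrier, ⟪x, x⟫_ℝ ≠ 2)
    (hmin : ∀ x ∈ L.dual, x ≠ 0 → m ≤ ⟪x, x⟫_ℝ) {s t : V}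
    (hs : s ∈ L.shell m) (ht : t ∈ L.shell m) (h : s - t ∈ L.carrier) : s = t := by
  by_contra hne
  obtain ⟨n, hn⟩ := L.even _ h
  have hst : ⟪s, t⟫_ℝ = m - n := by
    rw [real_inner_sub_sub_self, hs.2, ht.2] at hn
    linarith
  have h1 := inner_le_of_mem_shell hmin hs ht hne
  have h3 : -m ≤ ⟪s, t⟫_ℝ := by
    have : 0 ≤ ⟪s + t, s + t⟫_ℝ := real_inner_self_nonneg
    rw [real_inner_add_add_self, hs.2, ht.2] at this
    linarith
  have h4 : (0 : ℝ) < n := by linarith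
  have h5 : (n : ℝ) < 2 := by linarith
  have h6 : n = 1 := by
    have : 0 < n := by exact_mod_cast h4
    have : n < 2 := by exact_mod_cast h5
    omega
  subst h6
  exact h2 _ h (by rw [hn]; norm_num)

theorem shell_span_eq_top (hgen : L.dual ≤ Submodule.span ℤ (L.shell m)) :
    Submodule.span ℝ (L.shell m) = ⊤ := by
  rw [eq_top_iff, ← L.span_eq_top, Submodule.span_le]
  intro x hx
  have h := hgen (L.carrier_le_dual hx)
  clear hx
  induction h using Submodule.span_induction with
  | mem x hx => exact Submodule.subset_span hx
  | zero => exact zero_mem _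
  | add x y _ _ h1 h2 => exact add_mem h1 h2
  | smul n x _ h =>
    rw [← Int.cast_smul_eq_zsmul ℝ]
    exact Submodule.smul_mem _ _ h

/-- A family of vectors `τ s` with the same Gram matrix as a spanning family `s` is its image
under an isometry. -/
theorem exists_isometry_of_inner_eq {S : Set V} (hS : Submodule.span ℝ S = ⊤) (τ : S → V)
    (hτ : ∀ s t : S, ⟪τ s, τ t⟫_ℝ = ⟪(s : V), (t : V)⟫_ℝ) :
    ∃ g : V →ₗ[ℝ] V, (∀ s : S, g s = τ s) ∧ ∀ x y, ⟪g x, g y⟫_ℝ = ⟪x, y⟫_ℝ := by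
  let P := Finsupp.linearCombination ℝ (fun s : S => (s : V))
  let F := Finsupp.linearCombination ℝ τ
  have hP : Function.Surjective P := by
    rw [← LinearMap.range_eq_top, Finsupp.range_linearCombination, Subtype.range_coe, hS]
  have hinner : ∀ a b, ⟪F a, F b⟫_ℝ = ⟪P a, P b⟫_ℝ := by
    intro a b
    simp only [F, P, Finsupp.linearCombination_apply, Finsupp.sum, sum_inner, inner_sum,
      real_inner_smul_left, real_inner_smul_right, hτ]
  -- A linear relation is the vanishing of a norm, which the Gram matrix computes; hence the vectors
  -- `τ s` satisfy every relation satisfied by the `s`.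
  have hker : LinearMap.ker P ≤ LinearMap.ker F := by
    intro a ha
    rw [LinearMap.mem_ker] at ha ⊢
    rw [← inner_self_eq_zero (𝕜 := ℝ), hinner, ha, inner_zero_left]
  let g : V →ₗ[ℝ] V := (LinearMap.ker P).liftQ F hker ∘ₗ
    (P.quotKerEquivOfSurjective hP).symm.toLinearMap
  have hg : ∀ a, g (P a) = F a := by
    intro a
    have : (P.quotKerEquivOfSurjective hP).symm (P a) = Submodule.Quotient.mk a := by
      rw [LinearEquiv.symm_apply_eq]
      rfl
    change (LinearMap.ker P).liftQ F hker ((P.quotKerEquivOfSurjective hP).symm (P a)) = F a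
    rw [this]
    rfl
  refine ⟨g, fun s => ?_, fun x y => ?_⟩
  · simpa [P, F] using hg (Finsupp.single s 1)
  · obtain ⟨a, rfl⟩ := hP x
    obtain ⟨b, rfl⟩ := hP y
    rw [hg, hg, hinner]

/-- Under the hypotheses of `resHom_bijective`, isometries of the residue permute the
vectors of norm `m` and hence lift to `V`. -/
theorem exists_lift (hm0 : 0 < m) (hm : m < 1) (h2 : ∀ x ∈ L.carrier, ⟪x, x⟫_ℝ ≠ 2)
    (hmin : ∀ x ∈ L.dual, x ≠ 0 → m ≤ ⟪x, x⟫_ℝ)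
    (hgen : L.dual ≤ Submodule.span ℤ (L.shell m))
    (hrep : ∀ x ∈ L.dual, (∃ n : ℤ, ⟪x, x⟫_ℝ = m + 2 * n) →
      ∃ s ∈ L.shell m, x - s ∈ L.carrier) (σ : L.ORes) :
    ∃ g : V →ₗ[ℝ] V, (∀ x y, ⟪g x, g y⟫_ℝ = ⟪x, y⟫_ℝ) ∧
      ∀ x : L.dual, ∃ h : g x ∈ L.dual, L.toRes ⟨g x, h⟩ = σ.1 (L.toRes x) := by
  have huniq := fun {s t : V} => eq_of_mem_shell (s := s) (t := t) hm0 hm h2 hmin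
  -- The class `σ [s]` still has norm `m` modulo 2, so `hrep` provides a minimal vector in it.
  have hex : ∀ s : L.shell m, ∃ t : V, ∃ ht : t ∈ L.shell m,
      L.toRes ⟨t, ht.1⟩ = σ.1 (L.toRes ⟨s, s.2.1⟩) := by
    intro s
    obtain ⟨x, hx⟩ := Submodule.Quotient.mk_surjective _ (σ.1 (L.toRes ⟨s, s.2.1⟩))
    have hq := σ.2 (L.toRes ⟨s, s.2.1⟩)
    rw [← hx] at hq
    obtain ⟨n, hn⟩ := resQuad_eq_iff.1 hq
    obtain ⟨t, ht, hxt⟩ := hrep x x.2 ⟨n, by rw [hn, s.2.2]⟩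
    refine ⟨t, ht, ?_⟩
    rw [← hx]
    exact (toRes_eq_iff.2 hxt).symm
  choose τ hτ hτσ using hex
  have hinj : ∀ s t : L.shell m, τ s = τ t → (s : V) = t := by
    intro s t h
    refine huniq s.2 t.2 ?_
    refine toRes_eq_iff.1 (σ.1.injective (a₁ := L.toRes ⟨s, s.2.1⟩)
      (a₂ := L.toRes ⟨t, t.2.1⟩) ?_)
    rw [← hτσ, ← hτσ]
    congr 2
  -- Opposite pairs must be treated apart: the bound `|s·t| ≤ m / 2` fails exactly when `s = ±t`.
  have hnegτ : ∀ s t : L.shell m, (s : V) = -t ↔ τ s = -τ t := by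
    have key : ∀ t : L.shell m, τ ⟨-t, neg_mem_shell t.2⟩ = -τ t := by
      intro t
      refine huniq (hτ _) (neg_mem_shell (hτ t)) ?_
      refine (toRes_eq_iff (x := ⟨_, (hτ _).1⟩) (y := -⟨_, (hτ t).1⟩)).1 ?_
      have : L.toRes (-⟨τ t, (hτ t).1⟩) = -L.toRes ⟨τ t, (hτ t).1⟩ := rfl
      rw [this, hτσ, hτσ, ← map_neg]
      rfl
    intro s t
    constructor
    · intro h
      rw [← key t]
      congr 1
      exact Subtype.ext h
    · intro h
      rw [← key t] at h
      exact hinj _ _ h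
  have hgram : ∀ s t : L.shell m, ⟪τ s, τ t⟫_ℝ = ⟪(s : V), (t : V)⟫_ℝ := by
    intro s t
    by_cases hst : (s : V) = t
    · have : s = t := Subtype.ext hst
      subst this
      rw [(hτ s).2, s.2.2]
    by_cases hst' : (s : V) = -t
    · have := (hnegτ s t).1 hst'
      rw [this, hst', inner_neg_left, inner_neg_left, (hτ t).2, t.2.2]
    have hst1 : τ s ≠ τ t := fun h => hst (hinj s t h)
    have hst2 : τ s ≠ -τ t := fun h => hst' ((hnegτ s t).2 h)
    have b1 := inner_le_of_mem_shell hmin s.2 t.2 hst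
    have b2 := inner_le_of_mem_shell hmin s.2 (neg_mem_shell t.2) hst'
    have b3 := inner_le_of_mem_shell hmin (hτ s) (hτ t) hst1
    have b4 := inner_le_of_mem_shell hmin (hτ s) (neg_mem_shell (hτ t)) hst2
    rw [inner_neg_right] at b2 b4
    -- Polarization: comparing the form at `[s] + [t]` and at its image shows that `τ s · τ t` and
    -- `s · t` differ by an integer `n`. Both lie in `[-m/2, m/2]` and `m < 1`, so `n = 0`.
    have hq := σ.2 (L.toRes (⟨s, s.2.1⟩ + ⟨t, t.2.1⟩))
    have hsum : σ.1 (L.toRes (⟨s, s.2.1⟩ + ⟨t, t.2.1⟩)) =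
        L.toRes (⟨τ s, (hτ s).1⟩ + ⟨τ t, (hτ t).1⟩) := by
      have h1 : L.toRes (⟨s, s.2.1⟩ + ⟨t, t.2.1⟩) =
        L.toRes ⟨s, s.2.1⟩ + L.toRes ⟨t, t.2.1⟩ := rfl
      rw [h1, map_add, ← hτσ, ← hτσ]
      rfl
    rw [hsum, resQuad_eq_iff] at hq
    obtain ⟨n, hn⟩ := hq
    simp only [Submodule.coe_add, real_inner_add_add_self, (hτ _).2, s.2.2, t.2.2] at hn
    have h1 : (n : ℝ) < 1 := by linarith
    have h2 : (-1 : ℝ) < n := by linarith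
    have h3 : n = 0 := by
      have : n < 1 := by exact_mod_cast h1
      have : -1 < n := by exact_mod_cast h2
      omega
    rw [h3] at hn
    push_cast at hn
    linarith
  obtain ⟨g, hgτ, hg⟩ := exists_isometry_of_inner_eq (shell_span_eq_top hgen) τ hgram
  refine ⟨g, hg, ?_⟩
  rintro ⟨x, hx⟩
  have key : ∀ y ∈ Submodule.span ℤ (L.shell m), ∃ hy : y ∈ L.dual, ∃ h : g y ∈ L.dual,
      L.toRes ⟨g y, h⟩ = σ.1 (L.toRes ⟨y, hy⟩) := by
    intro y hy
    induction hy using Submodule.span_induction with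
    | mem y hy =>
      have h := hgτ ⟨y, hy⟩
      simp only at h
      refine ⟨hy.1, h ▸ (hτ _).1, ?_⟩
      rw [← hτσ ⟨y, hy⟩]
      congr 2
    | zero =>
      refine ⟨zero_mem _, by rw [map_zero]; exact zero_mem _, ?_⟩
      have h1 : L.toRes ⟨0, zero_mem _⟩ = 0 := rfl
      rw [h1, map_zero σ.1]
      exact congrArg L.toRes (Subtype.ext (map_zero g))
    | add y z _ _ h1 h2 =>
      obtain ⟨hy, hgy, ey⟩ := h1
      obtain ⟨hz, hgz, ez⟩ := h2
      refine ⟨add_mem hy hz, by rw [map_add]; exact add_mem hgy hgz, ?_⟩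
      have h1 : L.toRes ⟨y + z, add_mem hy hz⟩ = L.toRes ⟨y, hy⟩ + L.toRes ⟨z, hz⟩ := rfl
      have h2 : L.toRes ⟨g y + g z, add_mem hgy hgz⟩ =
        L.toRes ⟨g y, hgy⟩ + L.toRes ⟨g z, hgz⟩ := rfl
      rw [h1, map_add σ.1, ← ey, ← ez]
      exact (congrArg L.toRes (Subtype.ext (map_add g y z))).trans h2
    | smul n y _ h =>
      obtain ⟨hy, hgy, ey⟩ := h
      refine ⟨Submodule.smul_mem _ n hy, by rw [map_zsmul]; exact Submodule.smul_mem _ n hgy, ?_⟩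
      have h1 : L.toRes ⟨n • y, Submodule.smul_mem _ n hy⟩ = n • L.toRes ⟨y, hy⟩ := rfl
      have h2 : L.toRes ⟨n • g y, Submodule.smul_mem _ n hgy⟩ = n • L.toRes ⟨g y, hgy⟩ := rfl
      rw [h1, map_smul σ.1, ← ey]
      exact (congrArg L.toRes (Subtype.ext (map_zsmul g n y))).trans h2
  obtain ⟨_, h⟩ := key x (hgen hx)
  exact h

/-- Suppose that the nonzero vectors of `L♯` have norm at least `m`, where `0 < m < 1`, that `L`
has no vectors of norm `2`, and that the vectors of norm `m` generate `L♯` and represent all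
the classes of `L♯ / L` of norm `m` modulo `2`. Then `O(L) → O(res L)` is bijective. -/
theorem resHom_bijective [FiniteDimensional ℝ V] (hm0 : 0 < m) (hm : m < 1)
    (h2 : ∀ x ∈ L.carrier, ⟪x, x⟫_ℝ ≠ 2)
    (hmin : ∀ x ∈ L.dual, x ≠ 0 → m ≤ ⟪x, x⟫_ℝ)
    (hgen : L.dual ≤ Submodule.span ℤ (L.shell m))
    (hrep : ∀ x ∈ L.dual, (∃ n : ℤ, ⟪x, x⟫_ℝ = m + 2 * n) →
      ∃ s ∈ L.shell m, x - s ∈ L.carrier) : Function.Bijective L.resHom := by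
  have huniq := fun {s t : V} => eq_of_mem_shell (s := s) (t := t) hm0 hm h2 hmin
  have hspan := shell_span_eq_top hgen
  constructor
  · rw [injective_iff_map_eq_one]
    intro f hf
    have hfix : (L.extendEquiv f.1).toLinearMap = LinearMap.id := by
      refine LinearMap.ext_on hspan fun s hs => ?_
      refine huniq ⟨L.extendEquiv_mem_dual f hs.1, ?_⟩ hs ?_
      · exact (L.inner_extendEquiv f s s).trans hs.2
      · have h : (L.resHom f).1 (L.toRes ⟨s, hs.1⟩) = L.toRes ⟨s, hs.1⟩ := by rw [hf]; rfl
        exact (toRes_eq_iff (x := L.dualMap f ⟨s, hs.1⟩)).1 h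
    refine Subtype.ext (LinearEquiv.ext fun x => Subtype.ext ?_)
    rw [← L.extendEquiv_apply]
    exact LinearMap.congr_fun hfix x
  · intro σ
    obtain ⟨g, hg, hgσ⟩ := exists_lift hm0 hm h2 hmin hgen hrep σ
    obtain ⟨g', hg', hgσ'⟩ := exists_lift hm0 hm h2 hmin hgen hrep σ⁻¹
    -- `L` is the zero class, so a lift of an automorphism of the residue preserves it.
    have hL : ∀ (ψ : L.ORes) (h : V →ₗ[ℝ] V), (∀ x : L.dual, ∃ h' : h x ∈ L.dual,
        L.toRes ⟨h x, h'⟩ = ψ.1 (L.toRes x)) → ∀ x ∈ L.carrier, h x ∈ L.carrier := by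
      intro ψ h hh x hx
      obtain ⟨h', e⟩ := hh ⟨x, L.carrier_le_dual hx⟩
      have h0 : L.toRes ⟨x, L.carrier_le_dual hx⟩ = L.toRes 0 :=
        toRes_eq_iff.2 (by simpa using hx)
      rw [h0] at e
      have h1 : ψ.1 (L.toRes 0) = L.toRes 0 := map_zero _
      rw [h1] at e
      simpa using toRes_eq_iff.1 e
    -- The composite of lifts of `ψ` and `ψ⁻¹` moves each minimal vector within its class, hence
    -- fixes it.
    have hcomp : ∀ (ψ : L.ORes) (h h' : V →ₗ[ℝ] V), (∀ x y, ⟪h x, h y⟫_ℝ = ⟪x, y⟫_ℝ) →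
        (∀ x y, ⟪h' x, h' y⟫_ℝ = ⟪x, y⟫_ℝ) →
        (∀ x : L.dual, ∃ a : h x ∈ L.dual, L.toRes ⟨h x, a⟩ = ψ.1 (L.toRes x)) →
        (∀ x : L.dual, ∃ a : h' x ∈ L.dual, L.toRes ⟨h' x, a⟩ = ψ⁻¹.1 (L.toRes x)) →
        h' ∘ₗ h = LinearMap.id := by
      intro ψ h h' hi hi' hr hr'
      refine LinearMap.ext_on hspan fun s hs => ?_
      obtain ⟨a, ea⟩ := hr ⟨s, hs.1⟩
      obtain ⟨b, eb⟩ := hr' ⟨h s, a⟩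
      refine huniq ⟨b, ?_⟩ hs ?_
      · exact (hi' _ _).trans ((hi _ _).trans hs.2)
      · refine (toRes_eq_iff (x := ⟨_, b⟩) (y := ⟨s, hs.1⟩)).1 ?_
        rw [eb, ea]
        exact ψ.1.symm_apply_apply _
    have hc1 := hcomp σ g g' hg hg' hgσ hgσ'
    have hc2 := hcomp σ⁻¹ g' g hg' hg hgσ' (by rwa [inv_inv])
    let f : L.carrier ≃ₗ[ℤ] L.carrier := LinearEquiv.ofLinearMap
      ((g.restrictScalars ℤ).restrict (hL σ g hgσ))
      ((g'.restrictScalars ℤ).restrict (hL σ⁻¹ g' hgσ'))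
      (LinearMap.ext fun x => Subtype.ext (LinearMap.congr_fun hc2 x))
      (LinearMap.ext fun x => Subtype.ext (LinearMap.congr_fun hc1 x))
    have hf : f ∈ L.O := fun x => by
      change ⟪g x, g x⟫_ℝ / 2 = ⟪(x : V), (x : V)⟫_ℝ / 2
      rw [hg]
    have hext : (L.extendEquiv f).toLinearMap = g :=
      L.eq_of_eq_on fun x hx => L.extendEquiv_apply f ⟨x, hx⟩
    refine ⟨⟨f, hf⟩, Subtype.ext (LinearEquiv.ext fun x => ?_)⟩
    obtain ⟨x, rfl⟩ := Submodule.Quotient.mk_surjective _ x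
    obtain ⟨h, e⟩ := hgσ x
    refine Eq.trans ?_ e
    change L.toRes (L.dualMap ⟨f, hf⟩ x) = _
    congr 1
    exact Subtype.ext (LinearMap.congr_fun hext x)

end EvenLattice

/-! ### Arithmetic of integral arrays modulo `l + 1`. -/

section Arrays

variable {k l : ℕ}

/-- The residue of an index modulo `l + 1`. -/
def idx (r : Fin (l + 1)) : ZMod (l + 1) := ((r : ℕ) : ZMod (l + 1))

theorem idx_injective : Function.Injective (idx (l := l)) := by
  intro r s h
  have h1 := (ZMod.natCast_eq_natCast_iff' _ _ _).1 h
  rw [Nat.mod_eq_of_lt r.2, Nat.mod_eq_of_lt s.2] at h1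
  exact Fin.ext h1

theorem idx_bijective : Function.Bijective (idx (l := l)) :=
  (Fintype.bijective_iff_injective_and_card _).2 ⟨idx_injective, by simp [ZMod.card]⟩

/-- With `l + 1` prime, a row of nonzero slope meets each residue exactly once. -/
theorem sum_affine_idx [Fact (l + 1).Prime] {M : Type*} [AddCommMonoid M]
    (f : ZMod (l + 1) → M) (a : ZMod (l + 1)) {b : ZMod (l + 1)} (hb : b ≠ 0) :
    ∑ r, f (a + b * idx r) = ∑ x, f x := by
  refine Fintype.sum_bijective (fun r => a + b * idx r) ?_ _ _ fun _ => rfl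
  exact ((AddGroup.addLeft_bijective a).comp (mulLeft_bijective₀ b hb)).comp idx_bijective

/-- The integral arrays with zero row sums and weighted sum divisible by `l + 1`. -/
structure IsLatArray (z : Fin k × Fin (l + 1) → ℤ) : Prop where
  row_sum : ∀ c, ∑ r, z (c, r) = 0
  weighted_sum : ∑ t, (z t : ZMod (l + 1)) * idx t.2 = 0

/-- The multiples by `l + 1` of the elements of the lattice dual to `IsLatArray`. -/
structure IsDualArray (u : Fin k × Fin (l + 1) → ℤ) : Prop where
  row_sum : ∀ c, ∑ r, u (c, r) = 0
  affine : ∃ (a : Fin k → ZMod (l + 1)) (b : ZMod (l + 1)),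
    ∀ c r, (u (c, r) : ZMod (l + 1)) = a c + b * idx r

/-- The numerical conditions satisfied by `3 𝐀₂` and `2 𝐀₄`. -/
structure IsAdmissible (k l : ℕ) : Prop where
  pos : 0 < k
  prime : (l + 1).Prime
  sum_valMinAbs : ∑ x : ZMod (l + 1), x.valMinAbs = 0
  sum_valMinAbs_sq : k * ∑ x : ZMod (l + 1), x.valMinAbs ^ 2 = (l + 1) * l
  sum_sq_eq_one : ∀ a : Fin k → ZMod (l + 1), ∑ c, a c ^ 2 = 1 →
    ∃ c, (a c = 1 ∨ a c = -1) ∧ ∀ d, d ≠ c → a d = 0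

/-- The centered residues are `0, ±1`, with `3 · 2 = 3 · 2`. Nonzero squares in `𝔽₃` equal 1, so
three squares sum to 1 only when exactly one is nonzero. -/
theorem isAdmissible_three_two : IsAdmissible 3 2 :=
  ⟨by decide, by decide, by decide, by decide, by decide⟩

/-- The centered residues are `0, ±1, ±2`, with `2 · 10 = 5 · 4`. Squares in `𝔽₅` are `0, ±1`, so
two of them sum to 1 only as `1 + 0`. -/
theorem isAdmissible_two_four : IsAdmissible 2 4 :=
  ⟨by decide, by decide, by decide, by decide, by decide⟩

/-- A zero row sum forces two nonzero entries in one row, so norm 2 leaves only `±(e_r - e_s)`. Its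
weighted sum `±(r - s)` is nonzero modulo `l + 1`: no root lies in the sublattice. -/
theorem IsLatArray.sum_sq_ne_two {z : Fin k × Fin (l + 1) → ℤ} (hz : IsLatArray z) :
    ∑ t, z t ^ 2 ≠ 2 := by
  intro h
  obtain ⟨⟨c, r⟩, hr⟩ : ∃ t, z t ≠ 0 := by
    by_contra! h0
    simp [h0] at h
  obtain ⟨s, hsr, hs⟩ : ∃ s, s ≠ r ∧ z (c, s) ≠ 0 := by
    by_contra! h0
    have := hz.row_sum c
    rw [Finset.sum_eq_single r (fun s _ h => h0 s h) (by simp)] at this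
    exact hr this
  have hne : (c, r) ≠ (c, s) := fun h => hsr (Prod.ext_iff.1 h).2.symm
  have hsplit : ∀ {M : Type} [AddCommGroup M] (f : Fin k × Fin (l + 1) → M),
      ∑ t, f t = f (c, r) + f (c, s) + ∑ t ∈ Finset.univ \ {(c, r), (c, s)}, f t := by
    intro M _ f
    rw [← Finset.sum_pair hne]
    exact ((add_comm _ _).trans (Finset.sum_sdiff (Finset.subset_univ _))).symm
  have sq_pos : ∀ {x : ℤ}, x ≠ 0 → 1 ≤ x ^ 2 := fun {x} hx => by
    have := sq_pos_of_ne_zero (a := x) hx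
    omega
  have h1 := sq_pos hr
  have h2 := sq_pos hs
  rw [hsplit] at h
  have hrest : ∑ t ∈ Finset.univ \ {(c, r), (c, s)}, z t ^ 2 = 0 :=
    le_antisymm (by linarith) (Finset.sum_nonneg fun t _ => sq_nonneg _)
  rw [Finset.sum_eq_zero_iff_of_nonneg fun t _ => sq_nonneg _] at hrest
  have hzero : ∀ t, t ≠ (c, r) → t ≠ (c, s) → z t = 0 := fun t h h' =>
    pow_eq_zero_iff two_ne_zero |>.1 (hrest t (by simp [h, h']))
  have hrow : z (c, r) + z (c, s) = 0 := by
    rw [← hz.row_sum c, ← Finset.sum_pair (f := fun r => z (c, r)) hsr.symm]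
    refine Finset.sum_subset (Finset.subset_univ _) fun i _ hi => ?_
    simp only [Finset.mem_insert, Finset.mem_singleton, not_or] at hi
    exact hzero _ (fun h => hi.1 (Prod.ext_iff.1 h).2) (fun h => hi.2 (Prod.ext_iff.1 h).2)
  have hw := hz.weighted_sum
  rw [hsplit, Finset.sum_eq_zero (s := Finset.univ \ _)] at hw
  · have hs' : z (c, s) = -z (c, r) := by linarith
    have hz1 : z (c, r) ^ 2 = 1 := by
      have : ∑ t ∈ Finset.univ \ {(c, r), (c, s)}, z t ^ 2 = 0 := Finset.sum_eq_zero hrest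
      rw [this, hs'] at h
      linarith
    have hz2 : (z (c, r) : ZMod (l + 1)) ^ 2 = 1 := by exact_mod_cast congrArg Int.cast hz1
    have : idx r - idx s = 0 := by
      rw [hs'] at hw
      push_cast at hw
      linear_combination (z (c, r) : ZMod (l + 1)) * hw - (idx r - idx s) * hz2
    exact hsr (idx_injective (sub_eq_zero.1 this)).symm
  · intro t ht
    simp only [Finset.mem_sdiff, Finset.mem_univ, true_and, Finset.mem_insert,
      Finset.mem_singleton, not_or] at ht
    rw [hzero t ht.1 ht.2]
    simp

/-! ### The minimum of the dual arrays. -/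

/-- An integral vector of sum zero with all entries congruent modulo `l + 1`. -/
theorem exists_row_eq {u : Fin (l + 1) → ℤ} (hu : ∑ r, u r = 0)
    (hc : ∀ r s, (u r : ZMod (l + 1)) = u s) (r₀ : Fin (l + 1)) :
    ∃ v : Fin (l + 1) → ℤ, v r₀ = 0 ∧ ∀ r, u r = (l + 1) * v r - ∑ s, v s := by
  have h1 : ∀ r, ∃ n : ℤ, u r = u r₀ + (l + 1) * n := by
    intro r
    obtain ⟨n, hn⟩ := (ZMod.intCast_eq_intCast_iff_dvd_sub _ _ _).1 (hc r₀ r)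
    refine ⟨n, ?_⟩
    push_cast at hn
    linarith
  choose v hv using h1
  have hl : (l + 1 : ℤ) ≠ 0 := by positivity
  have h0 : u r₀ = -∑ s, v s := by
    have : (l + 1 : ℤ) * (u r₀ + ∑ s, v s) = 0 := by
      rw [← hu, Finset.sum_congr rfl fun r _ => hv r, Finset.sum_add_distrib, ← Finset.mul_sum]
      simp
      ring
    have := (mul_eq_zero.1 this).resolve_left hl
    linarith
  refine ⟨v, ?_, fun r => ?_⟩
  · have := hv r₀
    have h : (l + 1 : ℤ) * v r₀ = 0 := by linarith
    exact (mul_eq_zero.1 h).resolve_left hl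
  · rw [hv r, h0]
    ring

theorem sum_sq_row {u v : Fin (l + 1) → ℤ} (h : ∀ r, u r = (l + 1) * v r - ∑ s, v s) :
    ∑ r, u r ^ 2 = (l + 1) * ((l + 1) * ∑ r, v r ^ 2 - (∑ r, v r) ^ 2) := by
  simp only [h, sub_sq, mul_pow, Finset.sum_add_distrib, Finset.sum_sub_distrib,
    ← Finset.mul_sum, ← Finset.sum_mul, Finset.sum_const, Finset.card_univ, Fintype.card_fin,
    nsmul_eq_mul]
  push_cast
  ring

/-- Let `f` be the size of the support of `v`, `W = ∑ v²` and `A = ∑ v`. Cauchy-Schwarz gives `A² ≤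
f W`, and `W ≥ f`, so `(l + 1) W - A² ≥ f (l + 1 - f) = l + (f - 1)(l - f)`. The normalization `v r₀
= 0` at an index with `u r₀ ≠ 0` ensures `1 ≤ f ≤ l`. -/
theorem le_sum_sq_row {u : Fin (l + 1) → ℤ} (hu : ∑ r, u r = 0)
    (hc : ∀ r s, (u r : ZMod (l + 1)) = u s) (h0 : ∃ r, u r ≠ 0) :
    ((l + 1) * l : ℤ) ≤ ∑ r, u r ^ 2 := by
  obtain ⟨r₀, h0⟩ := h0
  obtain ⟨v, hv0, hv⟩ := exists_row_eq hu hc r₀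
  rw [sum_sq_row hv]
  let F : Finset (Fin (l + 1)) := Finset.univ.filter fun r => v r ≠ 0
  have hA : ∑ r, v r = ∑ r ∈ F, v r := (Finset.sum_filter_ne_zero _).symm
  have hW : ∑ r, v r ^ 2 = ∑ r ∈ F, v r ^ 2 := by
    rw [Finset.sum_filter]
    refine Finset.sum_congr rfl fun r _ => ?_
    by_cases h : v r = 0 <;> simp [h]
  have hcs : (∑ r ∈ F, v r) ^ 2 ≤ F.card * ∑ r ∈ F, v r ^ 2 := sq_sum_le_card_mul_sum_sq
  have hWF : (F.card : ℤ) ≤ ∑ r ∈ F, v r ^ 2 := by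
    rw [Finset.card_eq_sum_ones, Nat.cast_sum]
    refine Finset.sum_le_sum fun r hr => ?_
    have := sq_pos_of_ne_zero (a := v r) (Finset.mem_filter.1 hr).2
    push_cast
    omega
  have hF1 : (1 : ℤ) ≤ F.card := by
    have : F.Nonempty := by
      rw [Finset.nonempty_iff_ne_empty]
      intro hF
      rw [hv r₀, hv0, hA, hF] at h0
      simp at h0
    exact_mod_cast this.card_pos
  have hF2 : (F.card : ℤ) ≤ l := by
    have : F.card < Fintype.card (Fin (l + 1)) := by
      rw [← Finset.card_univ]
      refine Finset.card_lt_card (Finset.ssubset_univ_iff.2 fun h => ?_)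
      have : r₀ ∈ F := h ▸ Finset.mem_univ r₀
      exact (Finset.mem_filter.1 this).2 hv0
    rw [Fintype.card_fin] at this
    exact_mod_cast Nat.lt_succ_iff.1 this
  rw [hA, hW]
  refine mul_le_mul_of_nonneg_left ?_ (by positivity)
  nlinarith [mul_nonneg (sub_nonneg.2 hF1) (sub_nonneg.2 hF2),
    mul_le_mul_of_nonneg_left hWF (show (0 : ℤ) ≤ l + 1 - F.card by linarith)]

theorem valMinAbs_sq_le {n : ℕ} [NeZero n] (x : ℤ) : (x : ZMod n).valMinAbs ^ 2 ≤ x ^ 2 := by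
  refine sq_le_sq.2 ?_
  have := ZMod.natAbs_min_of_le_div_two n (x : ZMod n).valMinAbs x (by simp)
    (ZMod.natAbs_valMinAbs_le _)
  rw [Int.abs_eq_natAbs, Int.abs_eq_natAbs]
  exact_mod_cast this

/-- For slope 0, one nonzero row already suffices. For nonzero slope, every row meets all residues,
and each entry is at least as large in absolute value as its centered residue. -/
theorem IsDualArray.le_sum_sq (hkl : IsAdmissible k l) {u : Fin k × Fin (l + 1) → ℤ}
    (hu : IsDualArray u) (h0 : u ≠ 0) : ((l + 1) * l : ℤ) ≤ ∑ t, u t ^ 2 := by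
  have : Fact (l + 1).Prime := ⟨hkl.prime⟩
  obtain ⟨a, b, hab⟩ := hu.affine
  rw [Fintype.sum_prod_type]
  by_cases hb : b = 0
  · obtain ⟨⟨c, r⟩, hr⟩ := Function.ne_iff.1 h0
    refine (le_sum_sq_row (hu.row_sum c) (fun r s => ?_) ⟨r, hr⟩).trans ?_
    · rw [hab, hab, hb]
      ring
    · exact Finset.single_le_sum (f := fun c => ∑ r, u (c, r) ^ 2)
        (fun c _ => Finset.sum_nonneg fun r _ => sq_nonneg _) (Finset.mem_univ c)
  · rw [← hkl.sum_valMinAbs_sq]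
    have : ∀ c, ∑ x : ZMod (l + 1), x.valMinAbs ^ 2 ≤ ∑ r, u (c, r) ^ 2 := by
      intro c
      rw [← sum_affine_idx _ (a c) hb]
      refine Finset.sum_le_sum fun r _ => ?_
      rw [← hab]
      exact valMinAbs_sq_le _
    calc _ = ∑ c : Fin k, ∑ x : ZMod (l + 1), x.valMinAbs ^ 2 := by simp
      _ ≤ _ := Finset.sum_le_sum fun c _ => this c

/-- The array of centered representatives of an affine function with nonzero slope. -/
def centeredArray (a : Fin k → ZMod (l + 1)) (b : ZMod (l + 1)) (t : Fin k × Fin (l + 1)) : ℤ :=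
  (a t.1 + b * idx t.2).valMinAbs

theorem isDualArray_centeredArray (hkl : IsAdmissible k l) (a : Fin k → ZMod (l + 1))
    {b : ZMod (l + 1)} (hb : b ≠ 0) : IsDualArray (centeredArray a b) where
  row_sum c := by
    have : Fact (l + 1).Prime := ⟨hkl.prime⟩
    exact (sum_affine_idx ZMod.valMinAbs (a c) hb).trans hkl.sum_valMinAbs
  affine := ⟨a, b, fun c r => by simp [centeredArray]⟩

theorem sum_sq_centeredArray (hkl : IsAdmissible k l) (a : Fin k → ZMod (l + 1))
    {b : ZMod (l + 1)} (hb : b ≠ 0) : ∑ t, centeredArray a b t ^ 2 = (l + 1) * l := by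
  have : Fact (l + 1).Prime := ⟨hkl.prime⟩
  rw [← hkl.sum_valMinAbs_sq, Fintype.sum_prod_type]
  have : ∀ c, ∑ r, centeredArray a b (c, r) ^ 2 = ∑ x : ZMod (l + 1), x.valMinAbs ^ 2 :=
    fun c => sum_affine_idx (fun x => x.valMinAbs ^ 2) (a c) hb
  simp [this]

/-- The array `(l + 1) e_{c,r} - ∑ s, e_{c,s}`. -/
def weightArray (t u : Fin k × Fin (l + 1)) : ℤ :=
  if u.1 = t.1 then (if u.2 = t.2 then (l + 1 : ℤ) else 0) - 1 else 0

/-- The entries `l` and `-1` of the nonzero row agree modulo `l + 1`, so the slope is 0. -/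
theorem isDualArray_weightArray (t : Fin k × Fin (l + 1)) : IsDualArray (weightArray t) where
  row_sum c := by
    by_cases h : c = t.1 <;> simp [weightArray, h]
  affine := ⟨fun c => if c = t.1 then -1 else 0, 0, fun c r => by
    have : (l : ZMod (l + 1)) = -1 :=
      eq_neg_of_add_eq_zero_left (by exact_mod_cast ZMod.natCast_self (l + 1))
    by_cases h : c = t.1 <;> by_cases h' : r = t.2 <;> simp [weightArray, h, h', this]⟩

theorem sum_sq_weightArray (t : Fin k × Fin (l + 1)) :
    ∑ u, weightArray t u ^ 2 = (l + 1) * l := by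
  rw [Fintype.sum_prod_type, Finset.sum_eq_single t.1 _ (by simp)]
  · simp only [weightArray, if_true]
    have : ∀ r, ((if r = t.2 then (l + 1 : ℤ) else 0) - 1) ^ 2 =
        (if r = t.2 then (l + 1 : ℤ) ^ 2 - 2 * (l + 1) else 0) + 1 := fun r => by
      split_ifs <;> ring
    refine (Finset.sum_congr rfl fun r _ => this r).trans ?_
    simp only [Finset.sum_add_distrib, Finset.sum_ite_eq', Finset.mem_univ, if_true,
      Finset.sum_const, Finset.card_univ, Fintype.card_fin, nsmul_eq_mul]
    push_cast
    ring
  · intro c _ hc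
    simp [weightArray, hc]

theorem sum_mul_weightArray (v : Fin k × Fin (l + 1) → ℤ) (c : Fin k) (r : Fin (l + 1)) :
    ∑ t, v t * weightArray t (c, r) = (l + 1) * v (c, r) - ∑ s, v (c, s) := by
  rw [Fintype.sum_prod_type, Finset.sum_eq_single c _ (by simp)]
  · simp [weightArray, sub_mul, Finset.sum_sub_distrib, mul_comm (v _)]
  · intro d _ hd
    simp [weightArray, hd.symm]

theorem exists_array_eq {u : Fin k × Fin (l + 1) → ℤ} (hu : ∀ c, ∑ r, u (c, r) = 0)
    {a : Fin k → ZMod (l + 1)} (hab : ∀ c r, (u (c, r) : ZMod (l + 1)) = a c) :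
    ∃ v : Fin k × Fin (l + 1) → ℤ, ∀ c r, u (c, r) = (l + 1) * v (c, r) - ∑ s, v (c, s) := by
  have : ∀ c, ∃ v : Fin (l + 1) → ℤ, ∀ r, u (c, r) = (l + 1) * v r - ∑ s, v s := fun c => by
    obtain ⟨v, _, hv⟩ := exists_row_eq (hu c) (fun r s => by rw [hab, hab]) 0
    exact ⟨v, hv⟩
  choose v hv using this
  exact ⟨fun t => v t.1 t.2, hv⟩

/-! ### Minimal arrays generate the dual and represent its classes. -/

/-- The dual arrays of minimal norm. -/
def minArrays (k l : ℕ) : Set (Fin k × Fin (l + 1) → ℤ) :=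
  {s | IsDualArray s ∧ ∑ t, s t ^ 2 = (l + 1) * l}

/-- Subtracting a multiple of one centered array of slope 1 brings the slope to 0, where weight
arrays generate. -/
theorem IsDualArray.mem_span (hkl : IsAdmissible k l) {u : Fin k × Fin (l + 1) → ℤ}
    (hu : IsDualArray u) : u ∈ Submodule.span ℤ (minArrays k l) := by
  have : Fact (l + 1).Prime := ⟨hkl.prime⟩
  obtain ⟨a, b, hab⟩ := hu.affine
  let s : Fin k × Fin (l + 1) → ℤ := centeredArray 0 1
  have hs : IsDualArray s := isDualArray_centeredArray hkl 0 one_ne_zero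
  have hsm : s ∈ Submodule.span ℤ (minArrays k l) :=
    Submodule.subset_span ⟨hs, sum_sq_centeredArray hkl 0 one_ne_zero⟩
  let w := u - b.valMinAbs • s
  have hw : ∀ c, ∑ r, w (c, r) = 0 := fun c => by
    simp [w, Finset.sum_sub_distrib, hu.row_sum, ← Finset.mul_sum, hs.row_sum]
  have hwa : ∀ c r, (w (c, r) : ZMod (l + 1)) = a c := fun c r => by
    simp [w, hab, s, centeredArray]
  obtain ⟨v, hv⟩ := exists_array_eq hw hwa
  have hwm : w ∈ Submodule.span ℤ (minArrays k l) := by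
    have : w = ∑ t, v t • weightArray t := by
      ext ⟨c, r⟩
      rw [hv, ← sum_mul_weightArray, Finset.sum_apply]
      rfl
    rw [this]
    exact Submodule.sum_mem _ fun t _ => Submodule.smul_mem _ _
      (Submodule.subset_span ⟨isDualArray_weightArray t, sum_sq_weightArray t⟩)
  have : u = w + b.valMinAbs • s := by simp [w]
  rw [this]
  exact add_mem hwm (Submodule.smul_mem _ _ hsm)

theorem row_sum_of_eq_add_mul {u s z : Fin k × Fin (l + 1) → ℤ} (hu : ∀ c, ∑ r, u (c, r) = 0)
    (hs : ∀ c, ∑ r, s (c, r) = 0) (h : ∀ t, u t = s t + (l + 1) * z t) (c : Fin k) :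
    ∑ r, z (c, r) = 0 := by
  have h1 : ∑ r, u (c, r) = ∑ r, s (c, r) + (l + 1) * ∑ r, z (c, r) := by
    rw [Finset.mul_sum, ← Finset.sum_add_distrib]
    exact Finset.sum_congr rfl fun r _ => h _
  rw [hu, hs, zero_add] at h1
  exact (mul_eq_zero.1 h1.symm).resolve_left (by positivity)

theorem IsDualArray.exists_minArray (hkl : IsAdmissible k l) {u : Fin k × Fin (l + 1) → ℤ}
    (hu : IsDualArray u) {n : ℤ} (hn : ∑ t, u t ^ 2 = (l + 1) * l + 2 * (l + 1) ^ 2 * n) :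
    ∃ s ∈ minArrays k l, ∃ z, IsLatArray z ∧ ∀ t, u t = s t + (l + 1) * z t := by
  have : Fact (l + 1).Prime := ⟨hkl.prime⟩
  have hl : (l + 1 : ℤ) ≠ 0 := by positivity
  have hl0 : ((l : ZMod (l + 1)) + 1) = 0 := by exact_mod_cast ZMod.natCast_self (l + 1)
  obtain ⟨a, b, hab⟩ := hu.affine
  by_cases hb : b = 0
  · obtain ⟨v, hv⟩ := exists_array_eq hu.row_sum (a := a) (by simp [hab, hb])
    let A : Fin k → ℤ := fun c => ∑ r, v (c, r)
    -- Dividing the norm condition by `l + 1` gives `(l + 1) ∑ v² - ∑ A² = l + 2 (l + 1) n`; now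
    -- reduce modulo `l + 1`, where `l = -1`.
    have hA : ∑ c, (A c : ZMod (l + 1)) ^ 2 = 1 := by
      rw [Fintype.sum_prod_type,
        Finset.sum_congr rfl fun c _ => sum_sq_row (u := fun r => u (c, r))
          (v := fun r => v (c, r)) (hv c), ← Finset.mul_sum, Finset.sum_sub_distrib,
        ← Finset.mul_sum] at hn
      have h1 : (l + 1 : ℤ) * ∑ c, ∑ r, v (c, r) ^ 2 - ∑ c, A c ^ 2 = l + 2 * (l + 1) * n :=
        mul_left_cancel₀ hl (by linear_combination hn)
      have h2 := congrArg (Int.cast : ℤ → ZMod (l + 1)) h1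
      push_cast at h2
      rw [hl0] at h2
      linear_combination -h2 - hl0
    obtain ⟨c₀, hc₀, hc⟩ := hkl.sum_sq_eq_one _ hA
    obtain ⟨ε, hε, hεA⟩ : ∃ ε : ℤ, ε * ε = 1 ∧ (A c₀ : ZMod (l + 1)) = ε := by
      rcases hc₀ with h | h
      · exact ⟨1, by norm_num, by simp [h]⟩
      · exact ⟨-1, by norm_num, by simp [h]⟩
    have hB : ∀ c, ∃ n : ℤ, A c = (if c = c₀ then ε else 0) + (l + 1) * n := by
      intro c
      have : (((if c = c₀ then ε else 0 : ℤ)) : ZMod (l + 1)) = A c := by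
        split_ifs with h
        · rw [h, hεA]
        · rw [hc c h, Int.cast_zero]
      obtain ⟨n, hn⟩ := (ZMod.intCast_eq_intCast_iff_dvd_sub _ _ _).1 this
      refine ⟨n, ?_⟩
      push_cast at hn
      linarith
    choose B hB using hB
    -- Modulo the root lattice, `u / (l + 1)` is `ε` times a weight of the component `c₀`, whatever
    -- the column. The column `r₀` is the one that makes the weighted sum of the difference vanish.
    obtain ⟨r₀, hr₀⟩ := idx_bijective.2
      ((ε : ZMod (l + 1)) * ∑ t : Fin k × Fin (l + 1), ((v t - B t.1 : ℤ) : ZMod (l + 1)) * idx t.2)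
    let s : Fin k × Fin (l + 1) → ℤ := fun t => ε * weightArray (c₀, r₀) t
    have hw := isDualArray_weightArray (c₀, r₀)
    have hs : IsDualArray s := by
      obtain ⟨a', b', h'⟩ := hw.affine
      refine ⟨fun c => ?_, fun c => ε * a' c, ε * b', fun c r => ?_⟩
      · simp only [s, ← Finset.mul_sum, hw.row_sum, mul_zero]
      · simp only [s, Int.cast_mul, h']
        ring
    let z : Fin k × Fin (l + 1) → ℤ := fun t => v t - B t.1 - if t = (c₀, r₀) then ε else 0
    have husz : ∀ t, u t = s t + (l + 1) * z t := by
      rintro ⟨c, r⟩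
      have h1 := hB c
      have h2 := hv c r
      change u (c, r) = (l + 1) * v (c, r) - A c at h2
      rw [h2, h1]
      by_cases h : c = c₀ <;> by_cases h' : r = r₀ <;> simp [s, z, weightArray, h, h'] <;> ring
    refine ⟨s, ⟨hs, ?_⟩, z, ⟨row_sum_of_eq_add_mul hu.row_sum hs.row_sum husz, ?_⟩, husz⟩
    · rw [← sum_sq_weightArray (c₀, r₀)]
      refine Finset.sum_congr rfl fun t _ => ?_
      simp only [s]
      linear_combination weightArray (c₀, r₀) t ^ 2 * hε
    · have h1 : ∀ t, (z t : ZMod (l + 1)) * idx t.2 =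
          ((v t - B t.1 : ℤ) : ZMod (l + 1)) * idx t.2 -
            if t = (c₀, r₀) then (ε : ZMod (l + 1)) * idx t.2 else 0 := fun t => by
        simp only [z]
        split_ifs <;> push_cast <;> ring
      have hε' : (ε : ZMod (l + 1)) * ε = 1 := by exact_mod_cast congrArg Int.cast hε
      rw [Finset.sum_congr rfl fun t _ => h1 t, Finset.sum_sub_distrib,
        Finset.sum_ite_eq' Finset.univ, if_pos (Finset.mem_univ _), hr₀, ← mul_assoc, hε', one_mul,
        sub_self]
  · have hs := isDualArray_centeredArray hkl a hb
    have hsq := sum_sq_centeredArray hkl a hb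
    have hz : ∀ t, ∃ n : ℤ, u t = centeredArray a b t + (l + 1) * n := by
      rintro ⟨c, r⟩
      have : (centeredArray a b (c, r) : ZMod (l + 1)) = u (c, r) := by
        simp [centeredArray, hab]
      obtain ⟨n, hn⟩ := (ZMod.intCast_eq_intCast_iff_dvd_sub _ _ _).1 this
      refine ⟨n, ?_⟩
      push_cast at hn
      linarith
    choose z hz using hz
    have hrow := row_sum_of_eq_add_mul hu.row_sum hs.row_sum hz
    refine ⟨_, ⟨hs, hsq⟩, z, ⟨hrow, ?_⟩, hz⟩
    -- Parity lets the factor 2 cancel in the expansion of `∑ (s + (l + 1) z)²`, leaving `∑ s z`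
    -- divisible by `l + 1`. Modulo `l + 1` this sum is `b` times the weighted sum of `z`, and `b`
    -- is invertible.
    obtain ⟨e, he⟩ : (2 : ℤ) ∣ ∑ t, z t ^ 2 := by
      have h0 : ∑ t, z t = 0 := by
        rw [Fintype.sum_prod_type]
        exact Finset.sum_eq_zero fun c _ => hrow c
      rw [← sub_zero (∑ t, z t ^ 2), ← h0, ← Finset.sum_sub_distrib]
      refine Finset.dvd_sum fun t _ => ?_
      rw [sq, ← mul_sub_one]
      exact even_iff_two_dvd.1 (Int.even_mul_pred_self _)
    have h1 : ∑ t, u t ^ 2 = ∑ t, centeredArray a b t ^ 2 +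
        2 * (l + 1) * ∑ t, centeredArray a b t * z t + (l + 1) ^ 2 * ∑ t, z t ^ 2 := by
      rw [Finset.mul_sum, Finset.mul_sum, ← Finset.sum_add_distrib, ← Finset.sum_add_distrib]
      refine Finset.sum_congr rfl fun t _ => ?_
      rw [hz t]
      ring
    rw [hn, hsq, he] at h1
    have h2 : ∑ t, centeredArray a b t * z t = (l + 1) * (n - e) :=
      mul_left_cancel₀ (mul_ne_zero two_ne_zero hl) (by linear_combination -h1)
    have h3 := congrArg (Int.cast : ℤ → ZMod (l + 1)) h2
    push_cast at h3
    rw [hl0, zero_mul] at h3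
    have h4 : ∑ t, (centeredArray a b t : ZMod (l + 1)) * z t =
        b * ∑ t, (z t : ZMod (l + 1)) * idx t.2 := by
      have h5 : ∀ t, (centeredArray a b t : ZMod (l + 1)) * z t =
          a t.1 * z t + b * ((z t : ZMod (l + 1)) * idx t.2) := fun t => by
        simp only [centeredArray, ZMod.coe_valMinAbs]
        ring
      rw [Finset.sum_congr rfl fun t _ => h5 t, Finset.sum_add_distrib, ← Finset.mul_sum,
        Fintype.sum_prod_type]
      have h6 : ∀ c, ∑ r, a c * (z (c, r) : ZMod (l + 1)) = 0 := fun c => by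
        rw [← Finset.mul_sum]
        have := congrArg (Int.cast : ℤ → ZMod (l + 1)) (hrow c)
        push_cast at this
        rw [this, mul_zero]
      simp [h6]
    rw [h4] at h3
    exact (mul_eq_zero.1 h3).resolve_left hb

end Arrays

/-! ### From `k 𝐀_l` and its Weyl vector to arrays. -/

section Coordinates

variable {k l : ℕ}

theorem inner_eq_sum (x y : spaceA k l) :
    ⟪x, y⟫_ℝ = ∑ t, x.1 t * y.1 t := by
  rw [Submodule.coe_inner, PiLp.inner_apply]
  exact Finset.sum_congr rfl fun t _ => mul_comm _ _

theorem inner_rootA (x : spaceA k l) (c : Fin k) (i j : Fin (l + 1)) :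
    ⟪x, rootA c i j⟫_ℝ = (x : EuclideanSpace ℝ _) (c, i) - (x : EuclideanSpace ℝ _) (c, j) := by
  rw [Submodule.coe_inner, rootA, inner_sub_right, EuclideanSpace.inner_single_right,
    EuclideanSpace.inner_single_right]
  simp

theorem rootA_apply (c : Fin k) (i j : Fin (l + 1)) (t : Fin k × Fin (l + 1)) :
    (rootA c i j : EuclideanSpace ℝ _) t =
      (if t = (c, i) then 1 else 0) - if t = (c, j) then 1 else 0 := by
  simp [rootA, PiLp.single_apply]

theorem rootA_injOn : Set.InjOn
    (fun t : Fin k × Fin (l + 1) × Fin (l + 1) => (rootA t.1 t.2.1 t.2.2 : spaceA k l))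
    {t | t.2.1 ≠ t.2.2} := by
  rintro ⟨c, i, j⟩ (hij : i ≠ j) ⟨d, i', j'⟩ - h
  have h' := fun t => congrArg (fun x : spaceA k l => x.1 t) h
  simp only [rootA_apply] at h'
  have h1 := h' (c, i)
  have h2 := h' (c, j)
  have e1 : (c, i) = (d, i') := by
    by_contra hne
    rw [if_neg hne, if_pos rfl, if_neg (by simp [hij])] at h1
    split_ifs at h1 <;> norm_num at h1
  have e2 : (c, j) = (d, j') := by
    by_contra hne
    rw [if_neg hne, if_pos rfl, if_neg (by simp [hij.symm])] at h2
    split_ifs at h2 <;> norm_num at h2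
  rw [Prod.mk.injEq] at e1 e2
  rw [e1.1, e1.2, e2.2]

/-- Up to constants on the components, a Weyl vector of `k 𝐀_l` is a permutation of
`0, …, l` on each component. -/
theorem IsWeylVector.exists_perm {ρ : spaceA k l} (hρ : IsWeylVector (rootsA k l) ρ) :
    ∃ σ : Fin k → Equiv.Perm (Fin (l + 1)), ∀ x : spaceA k l,
      ⟪x, ρ⟫_ℝ = ∑ t : Fin k × Fin (l + 1), (x : EuclideanSpace ℝ _) t * (σ t.1 t.2 : ℕ) := by
  obtain ⟨v, hv, rfl⟩ := hρ
  let w : Fin k → Fin (l + 1) → ℝ := fun c i => (v : EuclideanSpace ℝ _) (c, i)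
  have hw : ∀ c, Function.Injective (w c) := by
    intro c i j h
    by_contra hij
    refine hv (rootA c i j) ?_ ?_
    · exact Finset.mem_image.2 ⟨(c, i, j), Finset.mem_filter.2 ⟨Finset.mem_univ _, hij⟩, rfl⟩
    · rw [inner_rootA]
      exact sub_eq_zero.2 h
  let below : Fin k → Fin (l + 1) → Finset (Fin (l + 1)) := fun c i =>
    Finset.univ.filter fun j => w c j < w c i
  let above : Fin k → Fin (l + 1) → Finset (Fin (l + 1)) := fun c i =>
    Finset.univ.filter fun j => w c i < w c j
  have hcard : ∀ c i, (below c i).card + (above c i).card = l := by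
    intro c i
    have hd : Disjoint (below c i) (above c i) := by
      refine Finset.disjoint_filter.2 fun j _ h => not_lt.2 h.le
    have hu : below c i ∪ above c i = Finset.univ.erase i := by
      ext j
      simp only [below, above, Finset.mem_union, Finset.mem_filter, Finset.mem_univ, true_and,
        Finset.mem_erase, and_true]
      rw [← ne_iff_lt_or_gt, (hw c).ne_iff]
    rw [← Finset.card_union_of_disjoint hd, hu, Finset.card_erase_of_mem (Finset.mem_univ _)]
    simp
  -- The permutation ranks the coordinates of `v` within each component.
  let n : Fin k → Fin (l + 1) → Fin (l + 1) := fun c i =>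
    ⟨(below c i).card, by have := hcard c i; omega⟩
  have hn : ∀ c, Function.Injective (n c) := by
    intro c
    have hlt : ∀ i j, w c i < w c j → n c i < n c j := by
      intro i j h
      change (below c i).card < (below c j).card
      refine Finset.card_lt_card (Finset.ssubset_iff_of_subset ?_ |>.2 ⟨i, ?_, ?_⟩)
      · exact fun a ha => Finset.mem_filter.2
          ⟨Finset.mem_univ _, (Finset.mem_filter.1 ha).2.trans h⟩
      · exact Finset.mem_filter.2 ⟨Finset.mem_univ _, h⟩
      · exact fun ha => lt_irrefl _ (Finset.mem_filter.1 ha).2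
    intro i j h
    refine hw c ?_
    rcases lt_trichotomy (w c i) (w c j) with h' | h' | h'
    · exact absurd h (hlt _ _ h').ne
    · exact h'
    · exact absurd h (hlt _ _ h').ne'
  refine ⟨fun c => Equiv.ofBijective (n c) (Finite.injective_iff_bijective.1 (hn c)), fun x => ?_⟩
  let y : Fin k → Fin (l + 1) → ℝ := fun c i => (x : EuclideanSpace ℝ _) (c, i)
  have hy : ∀ c, ∑ i, y c i = 0 := x.2
  change _ = ∑ t : Fin k × Fin (l + 1), y t.1 t.2 * ((below t.1 t.2).card : ℝ)
  have hsum : ⟪x, ∑ α ∈ rootsA k l with 0 < ⟪v, α⟫_ℝ, α⟫_ℝ =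
      ∑ c, ∑ i, ∑ j, if w c j < w c i then y c i - y c j else 0 := by
    rw [inner_sum, Finset.sum_filter, rootsA, Finset.sum_image, Finset.sum_filter,
      Fintype.sum_prod_type]
    · refine Finset.sum_congr rfl fun c _ => ?_
      rw [Fintype.sum_prod_type]
      refine Finset.sum_congr rfl fun i _ => Finset.sum_congr rfl fun j _ => ?_
      simp only [inner_rootA, sub_pos]
      by_cases h : i = j
      · simp [h]
      · simp [h, w, y]
    · intro a ha b hb h
      exact rootA_injOn (by simpa using ha) (by simpa using hb) h
  -- The coefficient of `y c i` is `#below - #above = 2 #below - l`; the constant `l` disappears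
  -- since `∑ y c i = 0`. The factor 2 absorbs the half in the Weyl vector.
  have hrow : ∀ c, ∑ i, ∑ j, (if w c j < w c i then y c i - y c j else 0) =
      2 * ∑ i, y c i * ((below c i).card : ℝ) := by
    intro c
    have h1 : ∀ i j, (if w c j < w c i then y c i - y c j else 0) =
        (if w c j < w c i then y c i else 0) - if w c j < w c i then y c j else 0 :=
      fun i j => by split_ifs <;> ring
    have h2 : ∀ i, (∑ j, if w c j < w c i then y c i else 0) = y c i * (below c i).card := by
      intro i
      rw [← Finset.sum_filter, Finset.sum_const, nsmul_eq_mul, mul_comm]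
    have h3 : ∀ j, (∑ i, if w c j < w c i then y c j else 0) =
        l * y c j - y c j * (below c j).card := by
      intro j
      rw [← Finset.sum_filter, Finset.sum_const, nsmul_eq_mul]
      have : ((below c j).card : ℝ) + (above c j).card = l := by exact_mod_cast hcard c j
      change ((above c j).card : ℝ) * _ = _
      linear_combination y c j * this
    simp only [h1, Finset.sum_sub_distrib, h2]
    rw [Finset.sum_comm, Finset.sum_congr rfl fun j _ => h3 j, Finset.sum_sub_distrib,
      ← Finset.mul_sum, hy]
    ring
  rw [real_inner_smul_right, hsum, Fintype.sum_prod_type, Finset.sum_congr rfl fun c _ => hrow c,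
    ← Finset.mul_sum]
  ring

variable (σ : Fin k → Equiv.Perm (Fin (l + 1)))

/-- The coordinates of a vector, permuted on each component. -/
def coord (x : spaceA k l) (t : Fin k × Fin (l + 1)) : ℝ :=
  (x : EuclideanSpace ℝ _) (t.1, (σ t.1).symm t.2)

theorem sum_perm {M : Type*} [AddCommMonoid M] (f : Fin k × Fin (l + 1) → M) :
    ∑ t : Fin k × Fin (l + 1), f (t.1, (σ t.1).symm t.2) = ∑ t, f t := by
  rw [Fintype.sum_prod_type, Fintype.sum_prod_type]
  exact Finset.sum_congr rfl fun c _ => Equiv.sum_comp (σ c).symm fun i => f (c, i)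

theorem inner_eq_sum_coord (x y : spaceA k l) :
    ⟪x, y⟫_ℝ = ∑ t, coord σ x t * coord σ y t := by
  rw [inner_eq_sum, ← sum_perm σ]
  rfl

theorem coord_row_sum (x : spaceA k l) (c : Fin k) : ∑ r, coord σ x (c, r) = 0 :=
  (Equiv.sum_comp (σ c).symm fun i => (x : EuclideanSpace ℝ _) (c, i)).trans (x.2 c)

theorem coord_injective : Function.Injective (coord σ) := by
  intro x y h
  apply Subtype.ext
  ext ⟨c, i⟩
  simpa [coord] using congrFun h (c, σ c i)

/-- The vector with prescribed integral coordinates (of zero row sums). -/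
def ofArray : (Fin k × Fin (l + 1) → ℤ) →ₗ[ℤ] spaceA k l :=
  Fintype.linearCombination ℤ
    fun t => (rootA t.1 ((σ t.1).symm t.2) ((σ t.1).symm 0) : spaceA k l)

theorem ofArray_apply (u : Fin k × Fin (l + 1) → ℤ) : ofArray σ u =
    ∑ t, u t • (rootA t.1 ((σ t.1).symm t.2) ((σ t.1).symm 0) : spaceA k l) := rfl

theorem rootA_mem_rootLattice (c : Fin k) (i j : Fin (l + 1)) :
    (rootA c i j : spaceA k l) ∈ rootLattice (rootsA k l) := by
  by_cases h : i = j
  · have : (rootA c i j : spaceA k l) = 0 := Subtype.ext (by rw [h]; exact sub_self _)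
    rw [this]
    exact zero_mem _
  · exact Submodule.subset_span (Finset.mem_coe.2
      (Finset.mem_image.2 ⟨(c, i, j), Finset.mem_filter.2 ⟨Finset.mem_univ _, h⟩, rfl⟩))

theorem ofArray_mem_rootLattice (u : Fin k × Fin (l + 1) → ℤ) :
    ofArray σ u ∈ rootLattice (rootsA k l) :=
  Submodule.sum_mem _ fun _ _ => Submodule.smul_mem _ _ (rootA_mem_rootLattice _ _ _)

theorem coord_ofArray {u : Fin k × Fin (l + 1) → ℤ} (hu : ∀ c, ∑ r, u (c, r) = 0)
    (t : Fin k × Fin (l + 1)) : coord σ (ofArray σ u) t = u t := by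
  obtain ⟨c, r⟩ := t
  have h1 : coord σ (ofArray σ u) (c, r) = ∑ t : Fin k × Fin (l + 1), (u t : ℝ) *
      ((if (c, r) = t then 1 else 0) - if (c, r) = (t.1, 0) then 1 else 0) := by
    rw [coord, ofArray_apply]
    simp only [Submodule.coe_sum, WithLp.ofLp_sum, Finset.sum_apply]
    refine Finset.sum_congr rfl fun t _ => ?_
    rw [← Int.cast_smul_eq_zsmul ℝ]
    simp only [Submodule.coe_smul, PiLp.smul_apply, rootA_apply, smul_eq_mul]
    obtain ⟨d, s⟩ := t
    by_cases h : c = d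
    · subst h
      simp
    · simp [h]
  have h2 : ∑ t : Fin k × Fin (l + 1), (u t : ℝ) * (if (c, r) = (t.1, 0) then 1 else 0) = 0 := by
    rw [Fintype.sum_prod_type]
    refine Finset.sum_eq_zero fun d _ => ?_
    change ∑ s, (u (d, s) : ℝ) * (if (c, r) = (d, 0) then 1 else 0) = 0
    rw [← Finset.sum_mul]
    have : ∑ s, (u (d, s) : ℝ) = 0 := by exact_mod_cast congrArg (Int.cast : ℤ → ℝ) (hu d)
    rw [this, zero_mul]
  simp only [h1, mul_sub, Finset.sum_sub_distrib, h2]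
  simp

theorem coord_add (x y : spaceA k l) (t : Fin k × Fin (l + 1)) :
    coord σ (x + y) t = coord σ x t + coord σ y t := rfl

theorem coord_sub (x y : spaceA k l) (t : Fin k × Fin (l + 1)) :
    coord σ (x - y) t = coord σ x t - coord σ y t := rfl

theorem coord_smul (a : ℝ) (x : spaceA k l) (t : Fin k × Fin (l + 1)) :
    coord σ (a • x) t = a * coord σ x t := rfl

theorem exists_coord_eq_int {x : spaceA k l} (hx : x ∈ rootLattice (rootsA k l))
    (t : Fin k × Fin (l + 1)) : ∃ n : ℤ, coord σ x t = n := by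
  induction hx using Submodule.span_induction with
  | mem x hx =>
    simp only [rootsA, Finset.coe_image, Set.mem_image] at hx
    obtain ⟨⟨c, i, j⟩, -, rfl⟩ := hx
    refine ⟨(if (t.1, (σ t.1).symm t.2) = (c, i) then 1 else 0) -
      if (t.1, (σ t.1).symm t.2) = (c, j) then 1 else 0, ?_⟩
    rw [coord, rootA_apply]
    push_cast
    rfl
  | zero => exact ⟨0, by simp [coord]⟩
  | add x y _ _ h1 h2 =>
    obtain ⟨m, hm⟩ := h1
    obtain ⟨n, hn⟩ := h2
    exact ⟨m + n, by rw [coord_add, hm, hn]; push_cast; rfl⟩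
  | smul a x _ h =>
    obtain ⟨n, hn⟩ := h
    exact ⟨a * n, by rw [← Int.cast_smul_eq_zsmul ℝ, coord_smul, hn]; push_cast; rfl⟩

variable {σ} {ρ : spaceA k l} {hρ : IsWeylVector (rootsA k l) ρ}

theorem weighted_sum_eq_zero_iff (z : Fin k × Fin (l + 1) → ℤ) :
    ∑ t, (z t : ZMod (l + 1)) * idx t.2 = 0 ↔
      ∃ n : ℤ, ∑ t, (z t : ℝ) * ((t.2 : ℕ) : ℝ) = (l + 1 : ℕ) * n := by
  have h1 : ∑ t, (z t : ZMod (l + 1)) * idx t.2 =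
      ((∑ t, z t * ((t.2 : ℕ) : ℤ) : ℤ) : ZMod (l + 1)) := by
    push_cast
    rfl
  rw [h1, ZMod.intCast_zmod_eq_zero_iff_dvd]
  refine exists_congr fun n => ?_
  exact_mod_cast Iff.rfl

theorem mem_latticeQ_iff (hσ : ∀ x : spaceA k l, ⟪x, ρ⟫_ℝ =
      ∑ t : Fin k × Fin (l + 1), (x : EuclideanSpace ℝ _) t * (σ t.1 t.2 : ℕ))
    {x : spaceA k l} : x ∈ (latticeQ k l ρ hρ).carrier ↔
      ∃ z, IsLatArray z ∧ ∀ t, coord σ x t = z t := by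
  have hσ' : ∀ x, ⟪x, ρ⟫_ℝ = ∑ t, coord σ x t * ((t.2 : ℕ) : ℝ) := fun x => by
    rw [hσ, ← sum_perm σ]
    simp [coord]
  have hmem : x ∈ (latticeQ k l ρ hρ).carrier ↔
    x ∈ rootLattice (rootsA k l) ∧ ∃ n : ℤ, ⟪x, ρ⟫_ℝ = (l + 1 : ℕ) * n := Iff.rfl
  rw [hmem, hσ']
  constructor
  · rintro ⟨hx, hn⟩
    choose z hz using exists_coord_eq_int σ hx
    simp only [hz] at hn
    refine ⟨z, ⟨fun c => ?_, (weighted_sum_eq_zero_iff z).2 hn⟩, hz⟩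
    have := coord_row_sum σ x c
    simp only [hz] at this
    exact_mod_cast this
  · rintro ⟨z, hz, hxz⟩
    have : x = ofArray σ z := coord_injective σ (funext fun t => by
      rw [hxz, coord_ofArray σ hz.row_sum])
    refine ⟨this ▸ ofArray_mem_rootLattice σ z, ?_⟩
    simp only [hxz]
    exact (weighted_sum_eq_zero_iff z).1 hz.weighted_sum

/-- Zero row sums kill the constants `a c`, and the weighted sum kills the slope `b`. -/
theorem IsDualArray.dvd_sum_mul {u z : Fin k × Fin (l + 1) → ℤ} (hu : IsDualArray u)
    (hz : IsLatArray z) : (l + 1 : ℤ) ∣ ∑ t, u t * z t := by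
  obtain ⟨a, b, hab⟩ := hu.affine
  have h : ((∑ t, u t * z t : ℤ) : ZMod (l + 1)) = 0 := by
    push_cast
    have h1 : ∀ t, (u t : ZMod (l + 1)) * z t =
        a t.1 * z t + b * ((z t : ZMod (l + 1)) * idx t.2) := fun t => by
      rw [hab t.1 t.2]
      ring
    rw [Finset.sum_congr rfl fun t _ => h1 t, Finset.sum_add_distrib, ← Finset.mul_sum,
      hz.weighted_sum, mul_zero, add_zero, Fintype.sum_prod_type]
    refine Finset.sum_eq_zero fun c _ => ?_
    have := congrArg (Int.cast : ℤ → ZMod (l + 1)) (hz.row_sum c)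
    push_cast at this
    exact (Finset.mul_sum _ _ (a c)).symm.trans (by rw [this, mul_zero])
  exact_mod_cast (ZMod.intCast_zmod_eq_zero_iff_dvd _ _).1 h

/-- The array `e_t - e_{(t.1, 0)}`. -/
def rootArray (t u : Fin k × Fin (l + 1)) : ℤ :=
  (if u = t then 1 else 0) - if u = (t.1, 0) then 1 else 0

theorem rootArray_row_sum (t : Fin k × Fin (l + 1)) (c : Fin k) :
    ∑ r, rootArray t (c, r) = 0 := by
  obtain ⟨d, s⟩ := t
  by_cases h : c = d <;> simp [rootArray, h]

theorem sum_mul_rootArray {R : Type*} [CommRing R] (f : Fin k × Fin (l + 1) → R)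
    (t : Fin k × Fin (l + 1)) : ∑ u, f u * (rootArray t u : R) = f t - f (t.1, 0) := by
  simp [rootArray, mul_sub, Finset.sum_sub_distrib]

/-- These are the test vectors for the dual: `t'` lies in column 1, so subtracting `m` copies of its
root cancels the weight of `t`. -/
theorem isLatArray_rootArray_sub {t t' : Fin k × Fin (l + 1)} (ht' : idx t'.2 = 1) {m : ℤ}
    (hm : idx t.2 = m) : IsLatArray (rootArray t - m • rootArray t') where
  row_sum c := by
    simp [Finset.sum_sub_distrib, ← Finset.mul_sum, rootArray_row_sum]
  weighted_sum := by
    have h0 : idx (0 : Fin (l + 1)) = 0 := by simp [idx]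
    have h : ∀ u : Fin k × Fin (l + 1),
        (((rootArray t - m • rootArray t') u : ℤ) : ZMod (l + 1)) * idx u.2 =
          idx u.2 * (rootArray t u : ZMod (l + 1)) -
            m * (idx u.2 * (rootArray t' u : ZMod (l + 1))) := fun u => by
      simp only [Pi.sub_apply, Pi.smul_apply, smul_eq_mul]
      push_cast
      ring
    rw [Finset.sum_congr rfl fun u _ => h u, Finset.sum_sub_distrib, ← Finset.mul_sum,
      sum_mul_rootArray (fun u => idx u.2), sum_mul_rootArray (fun u => idx u.2)]
    simp [h0, hm, ht']

/-- The prime 2 is excluded because its centered residues `0, 1` do not sum to zero. -/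
theorem IsAdmissible.even (hkl : IsAdmissible k l) : Even l := by
  rcases hkl.prime.eq_two_or_odd' with h | h
  · obtain rfl : l = 1 := by omega
    exact absurd hkl.sum_valMinAbs (by decide)
  · rw [Nat.odd_add_one, Nat.not_odd_iff_even] at h
    exact h

theorem mem_dual_latticeQ_iff (hkl : IsAdmissible k l) (hσ : ∀ x : spaceA k l, ⟪x, ρ⟫_ℝ =
      ∑ t : Fin k × Fin (l + 1), (x : EuclideanSpace ℝ _) t * (σ t.1 t.2 : ℕ))
    {x : spaceA k l} : x ∈ (latticeQ k l ρ hρ).dual ↔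
      ∃ u, IsDualArray u ∧ ∀ t, (l + 1) * coord σ x t = u t := by
  have hl : (l + 1 : ℝ) ≠ 0 := by positivity
  constructor
  · intro hx
    have hl0 : ((l : ZMod (l + 1)) + 1) = 0 := by exact_mod_cast ZMod.natCast_self (l + 1)
    have hint : ∀ z, IsLatArray z → ∃ n : ℤ, ∑ t, coord σ x t * z t = n := by
      intro z hz
      obtain ⟨n, hn⟩ := hx (ofArray σ z)
        ((mem_latticeQ_iff hσ).2 ⟨z, hz, coord_ofArray σ hz.row_sum⟩)
      refine ⟨n, ?_⟩
      rw [← hn, inner_eq_sum_coord σ]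
      exact Finset.sum_congr rfl fun t _ => by rw [coord_ofArray σ hz.row_sum]
    let t₁ : Fin k × Fin (l + 1) := (⟨0, hkl.pos⟩, ⟨1, hkl.prime.one_lt⟩)
    have ht₁ : idx t₁.2 = 1 := by simp [idx, t₁]
    let τ := coord σ x t₁ - coord σ x (t₁.1, 0)
    have key : ∀ (t : Fin k × Fin (l + 1)) (m : ℤ), idx t.2 = m →
        ∃ n : ℤ, coord σ x t - coord σ x (t.1, 0) - m * τ = n := by
      intro t m hm
      obtain ⟨n, hn⟩ := hint _ (isLatArray_rootArray_sub ht₁ hm)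
      refine ⟨n, ?_⟩
      rw [← hn]
      have h : ∀ u, coord σ x u * (((rootArray t - m • rootArray t₁) u : ℤ) : ℝ) =
          coord σ x u * (rootArray t u : ℝ) - m * (coord σ x u * (rootArray t₁ u : ℝ)) :=
        fun u => by
          simp only [Pi.sub_apply, Pi.smul_apply, smul_eq_mul]
          push_cast
          ring
      rw [Finset.sum_congr rfl fun u _ => h u, Finset.sum_sub_distrib, ← Finset.mul_sum,
        sum_mul_rootArray, sum_mul_rootArray]
    -- A zero root with `m = -(l + 1)` tests `(l + 1)` times the root of `t₁`: thus `(l + 1) τ` is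
    -- an integer `β`, the slope of the array.
    obtain ⟨β, hβ⟩ := key (t₁.1, 0) (-(l + 1)) (by
      push_cast
      rw [hl0]
      simp [idx])
    push_cast at hβ
    choose N hN using fun t : Fin k × Fin (l + 1) => key t (t.2 : ℕ) (by simp [idx])
    push_cast at hN
    obtain ⟨h, hh⟩ := hkl.even
    -- Evenness enters here: `∑ r = (l + 1) h` with `l = 2h`, so summing row `c` contributes the
    -- integer `h β` rather than a half-integer.
    have hrow : ∀ c, (l + 1) * coord σ x (c, 0) = ((-(h * β) - ∑ r, N (c, r) : ℤ) : ℝ) := by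
      intro c
      have h1 := coord_row_sum σ x c
      have h2 : ∀ r : Fin (l + 1), coord σ x (c, r) =
          coord σ x (c, 0) + ((r : ℕ) : ℝ) * τ + N (c, r) := fun r => by
        rw [← hN]
        ring
      have h3 : ∑ r : Fin (l + 1), ((r : ℕ) : ℝ) = (l + 1) * h := by
        have := Finset.sum_range_id_mul_two (l + 1)
        rw [Finset.sum_range, Nat.add_sub_cancel] at this
        have h' : (∑ r : Fin (l + 1), ((r : ℕ) : ℝ)) * 2 = (l + 1) * l := by exact_mod_cast this
        have h'' : (l : ℝ) = h + h := by exact_mod_cast hh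
        have h4 : (∑ r : Fin (l + 1), ((r : ℕ) : ℝ)) * 2 = (l + 1) * h * 2 := by
          rw [h']
          linear_combination (l + 1 : ℝ) * h''
        linarith
      rw [Finset.sum_congr rfl fun r _ => h2 r, Finset.sum_add_distrib, Finset.sum_add_distrib,
        ← Finset.sum_mul, h3] at h1
      simp only [Finset.sum_const, Finset.card_univ, Fintype.card_fin, nsmul_eq_mul] at h1
      push_cast at h1 ⊢
      linear_combination h1 - (h : ℝ) * hβ
    let a : Fin k → ℤ := fun c => -(h * β) - ∑ r, N (c, r)
    let u : Fin k × Fin (l + 1) → ℤ := fun t => a t.1 + (t.2 : ℕ) * β + (l + 1) * N t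
    have hu : ∀ t, (l + 1) * coord σ x t = u t := by
      intro t
      have h1 : (l + 1) * coord σ x (t.1, 0) = (a t.1 : ℝ) := hrow t.1
      have h2 := hN t
      simp only [u]
      push_cast
      linear_combination h1 + (l + 1 : ℝ) * h2 + ((t.2 : ℕ) : ℝ) * hβ
    refine ⟨u, ⟨fun c => ?_, fun c => a c, β, fun c r => ?_⟩, hu⟩
    · have : ∑ r, (u (c, r) : ℝ) = 0 := by
        rw [Finset.sum_congr rfl fun r _ => (hu (c, r)).symm, ← Finset.mul_sum, coord_row_sum,
          mul_zero]
      exact_mod_cast this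
    · simp only [u]
      push_cast
      rw [hl0, idx]
      ring
  · rintro ⟨u, hu, hxu⟩ y hy
    obtain ⟨z, hz, hyz⟩ := (mem_latticeQ_iff hσ).1 hy
    obtain ⟨n, hn⟩ := hu.dvd_sum_mul hz
    refine ⟨n, mul_left_cancel₀ hl ?_⟩
    rw [inner_eq_sum_coord σ, Finset.mul_sum]
    have h : ∀ t, (l + 1) * (coord σ x t * coord σ y t) = ((u t * z t : ℤ) : ℝ) := fun t => by
      rw [hyz, ← mul_assoc, hxu]
      push_cast
      rfl
    rw [Finset.sum_congr rfl fun t _ => h t, ← Int.cast_sum, hn]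
    push_cast
    rfl

theorem inner_self_of_coord {x : spaceA k l} {u : Fin k × Fin (l + 1) → ℤ}
    (hu : ∀ t, (l + 1) * coord σ x t = u t) :
    (l + 1 : ℝ) ^ 2 * ⟪x, x⟫_ℝ = ((∑ t, u t ^ 2 : ℤ) : ℝ) := by
  rw [inner_eq_sum_coord σ, Finset.mul_sum]
  push_cast
  refine Finset.sum_congr rfl fun t _ => ?_
  rw [← hu]
  ring

/-! ### The criterion applied with `m = l / (l + 1)`. -/

theorem latticeQ_resHom_bijective (hkl : IsAdmissible k l) (ρ : spaceA k l)
    (hρ : IsWeylVector (rootsA k l) ρ) : Function.Bijective (latticeQ k l ρ hρ).resHom := by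
  obtain ⟨σ, hσ⟩ := hρ.exists_perm
  have hl : (l + 1 : ℝ) ≠ 0 := by positivity
  have hpos : (0 : ℝ) < l := by
    have := hkl.prime.one_lt
    exact_mod_cast (show 0 < l by omega)
  have hshell : ∀ {x u}, IsDualArray u → (∀ t, (l + 1) * coord σ x t = u t) →
      ∑ t, u t ^ 2 = (l + 1) * l → x ∈ (latticeQ k l ρ hρ).shell (l / (l + 1)) := by
    intro x u hu hxu hs
    refine ⟨(mem_dual_latticeQ_iff hkl hσ).2 ⟨u, hu, hxu⟩, ?_⟩
    have h := inner_self_of_coord hxu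
    rw [hs] at h
    push_cast at h
    refine mul_left_cancel₀ (pow_ne_zero 2 hl) ?_
    rw [h]
    field_simp
  -- On arrays with zero row sums, `Ψ` undoes the scaling by `l + 1` and so carries dual arrays back
  -- to dual vectors.
  let Ψ : (Fin k × Fin (l + 1) → ℤ) →ₗ[ℤ] spaceA k l :=
    ((l + 1 : ℝ)⁻¹ • (LinearMap.id : spaceA k l →ₗ[ℝ] spaceA k l)).restrictScalars ℤ ∘ₗ ofArray σ
  have hΨ : ∀ {u}, (∀ c, ∑ r, u (c, r) = 0) → ∀ t, (l + 1) * coord σ (Ψ u) t = u t := by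
    intro u hu t
    change (l + 1) * coord σ ((l + 1 : ℝ)⁻¹ • ofArray σ u) t = u t
    rw [coord_smul, coord_ofArray σ hu, mul_inv_cancel_left₀ hl]
  refine EvenLattice.resHom_bijective (m := l / (l + 1)) (by positivity) ?_ ?_ ?_ ?_ ?_
  · rw [div_lt_one (by positivity)]
    linarith
  · intro x hx h
    obtain ⟨z, hz, hxz⟩ := (mem_latticeQ_iff hσ).1 hx
    refine hz.sum_sq_ne_two ?_
    rw [inner_eq_sum_coord σ] at h
    simp only [hxz, ← sq] at h
    exact_mod_cast h
  · intro x hx h0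
    obtain ⟨u, hu, hxu⟩ := (mem_dual_latticeQ_iff hkl hσ).1 hx
    have hu0 : u ≠ 0 := by
      rintro rfl
      refine h0 (coord_injective σ (funext fun t => ?_))
      have := hxu t
      simp only [Pi.zero_apply, Int.cast_zero, mul_eq_zero, hl, false_or] at this
      rw [this]
      rfl
    have h1 : ((l + 1) * l : ℝ) ≤ ((∑ t, u t ^ 2 : ℤ) : ℝ) := by
      exact_mod_cast hu.le_sum_sq hkl hu0
    rw [← inner_self_of_coord hxu] at h1
    rw [div_le_iff₀ (by positivity)]
    refine le_of_mul_le_mul_left ?_ (show (0 : ℝ) < l + 1 by positivity)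
    linarith
  · intro x hx
    obtain ⟨u, hu, hxu⟩ := (mem_dual_latticeQ_iff hkl hσ).1 hx
    have hx' : x = Ψ u := coord_injective σ (funext fun t =>
      mul_left_cancel₀ hl ((hxu t).trans (hΨ hu.row_sum t).symm))
    rw [hx']
    have h : Submodule.span ℤ (minArrays k l) ≤
        (Submodule.span ℤ ((latticeQ k l ρ hρ).shell (l / (l + 1)))).comap Ψ :=
      Submodule.span_le.2 fun s hs => Submodule.subset_span (hshell hs.1 (hΨ hs.1.row_sum) hs.2)
    exact h (hu.mem_span hkl)
  · rintro x hx ⟨n, hn⟩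
    obtain ⟨u, hu, hxu⟩ := (mem_dual_latticeQ_iff hkl hσ).1 hx
    have hn' : ∑ t, u t ^ 2 = (l + 1) * l + 2 * (l + 1) ^ 2 * n := by
      have h := inner_self_of_coord hxu
      rw [hn] at h
      have : ((∑ t, u t ^ 2 : ℤ) : ℝ) = (l + 1) * l + 2 * (l + 1) ^ 2 * n := by
        rw [← h]
        field_simp
      exact_mod_cast this
    obtain ⟨s, hs, z, hz, husz⟩ := hu.exists_minArray hkl hn'
    refine ⟨Ψ s, hshell hs.1 (hΨ hs.1.row_sum) hs.2, (mem_latticeQ_iff hσ).2 ⟨z, hz, fun t => ?_⟩⟩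
    refine mul_left_cancel₀ hl ?_
    rw [coord_sub, mul_sub, hxu, hΨ hs.1.row_sum, husz]
    push_cast
    ring

end Coordinates

end EvenLat

end

theorem mainTheorem10 :
    (∀ (ρ : EvenLat.spaceA 3 2) (hρ : EvenLat.IsWeylVector (EvenLat.rootsA 3 2) ρ),
      Function.Bijective (EvenLat.Q6 ρ hρ).resHom) ∧
    (∀ (ρ : EvenLat.spaceA 2 4) (hρ : EvenLat.IsWeylVector (EvenLat.rootsA 2 4) ρ),
      Function.Bijective (EvenLat.Q8 ρ hρ).resHom) := by
  exact ⟨EvenLat.latticeQ_resHom_bijective EvenLat.isAdmissible_three_two,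
    EvenLat.latticeQ_resHom_bijective EvenLat.isAdmissible_two_four⟩
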